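/- Let $m\ge 1$ and $l\ge 3$ be integers, let $\bar X>0$ and $M>0$ be real, and put $\lambda=m/\bar X$ and $K=lM$. Let $X(0),X(1),\dots$ be i.i.d. with the Gamma density $f(x)=\frac{\lambda^m}{\Gamma(m)}x^{m-1}e^{-\lambda x}$, $x\ge 0$ (mean $\bar X$), let $B(0)$ be a $[0,K]$-valued random variable independent of $(X(i))_i$, and let $B(i)$ be the energy stored under the on-off policy with buffer size $K$, $$B(i+1)=\min\bigl(B(i)-M\,\mathbf 1_{\{B(i)>M\}}+X(i),\,K\bigr).$$ **Notation.** Let $\mathrm j=\sqrt{-1}$, $\eta_k=2\pi k/m$ and, for integers $n\ge1$ and $z\in\mathbb C$, $\gamma(n,z)=(n-1)!\bigl(1-e^{-z}\sum_{i=0}^{n-1}z^i/i!\bigr)$. For $t,s\ge 0$ put $$C(x,t)=x^{m+t}+\frac1m\sum_{k=0}^{m-1}\Re\Bigl\{(\lambda e^{\mathrm j\eta_k})^{-(m+t)}e^{\lambda xe^{\mathrm j\eta_k}}\gamma\bigl(m+t+1,\lambda xe^{\mathrm j\eta_k}\bigr)\Bigr\},$$ $$F(t,s)=\sum_{b=0}^{s}\binom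 sb(K-M)^{s-b}\Bigl[\frac{b!\,M^{m+t+b+1}}{(m+t+b+1)!}+\frac1m\sum_{k=0}^{m-1}\Re\Bigl\{e^{\lambda Me^{\mathrm j\eta_k}}(\lambda e^{\mathrm j\eta_k})^{-(m+t+b+1)}\gamma\bigl(b+1,\lambda Me^{\mathrm j\eta_k}\bigr)-b!\sum_{w=0}^{m+t}(\lambda e^{\mathrm j\eta_k})^{w-(m+t)}\frac{M^{w+b+1}}{(w+b+1)!}\Bigr\}\Bigr],$$ $$H(t)=\lambda^{-(m+t+1)}\Bigl[\frac{\gamma(m+t+1,\lambda M)}{(m+t)!}+\frac1m\sum_{k=0}^{m-1}\Re\Bigl\{\rho_k-\sum_{w=0}^{m+t}\frac{e^{\mathrm j\eta_k(w-(m+t))}}{w!}\gamma(w+1,\lambda M)\Bigr\}\Bigr],$$ where $\rho_0=\lambda M$ and $\rho_k=e^{-\mathrm j\eta_k(m+t)}(1-e^{\mathrm j\eta_k})^{-1}\bigl(1-e^{-\lambda M(1-e^{\mathrm j\eta_k})}\bigr)$ for $k\ne 0$. Let $A$ be the real $m\times m$ matrix with entries, for $s,r\in\{0,\dots,m-1\}$,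 $$\begin{aligned}A_{sr}=\frac1{r!}\Biggl\{&\sum_{q=0}^{l-2}\lambda^{(q+2)m-r}e^{-\lambda M(q+1)}\sum_{t=0}^{(q+1)m-r-1}\frac{((q+1)M-K)^{(q+1)m-r-1-t}}{((q+1)m-r-1-t)!}\bigl(H(t)-\lambda^sF(t,s)\bigr)\\&-\sum_{q=1}^{l-2}\lambda^{(q+1)m}e^{-\lambda M(q+1)}\sum_{t=0}^{qm-1}\frac{((q+1)M-K)^{qm-1-t}}{(qm-1-t)!}\bigl(H(t)-\lambda^sF(t,s)\bigr)\\&+\sum_{q=0}^{l-2}e^{-\lambda M(q+1)}\sum_{t=qm}^{(q+1)m-r-1}\frac{\lambda^t((q+1)M-K)^t}{t!}\\&+\lambda^sK^s\sum_{q=0}^{l-2}\lambda^{qm}e^{-\lambda M(q+1)}\sum_{t=0}^{s}\binom st K^{-t}t!\Bigl[\frac{\lambda^{m-r}((q+1)M-K)^{(q+1)m-r+t}}{((q+1)m-r+t)!}-\frac{((q+1)M-K)^{qm+t}}{(qm+t)!}\Bigr]\Biggr\}.\end{aligned}$$ **Claim 1.** The process has a limiting distribution $\pi$ (independent of $B(0)$)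 on $[0,K]$: $\pi$ is a stationary probability distribution of the process, and for every initial distribution on $[0,K]$ the law of $B(i)$ converges to $\pi$ in total variation. It has a density $g\ge 0$ on $[0,K)$ and an atom of mass $\pi(K)>0$ at $K$, and there is a real vector $\alpha=(\alpha_0,\dots,\alpha_{m-1})^T$ with $(I+A)\alpha=\mathbf 1$ such that $$\pi(K)=e^{-\lambda K}\sum_{r=0}^{m-1}\frac{\alpha_r}{r!};$$ for $0\le x<M$, $$\begin{aligned}g(x)=e^{-\lambda x}\sum_{r=0}^{m-1}\frac{\alpha_r}{r!}\Biggl[&\sum_{q=0}^{l-2}\lambda^{(q+2)m-r}e^{-\lambda M(q+1)}\sum_{t=0}^{(q+1)m-r-1}\frac{((q+1)M-K)^{(q+1)m-r-1-t}}{((q+1)m-r-1-t)!\,(m+t)!}C(x,t)\\&-\sum_{q=1}^{l-2}\lambda^{(q+1)m}e^{-\lambda M(q+1)}\sum_{t=0}^{qm-1}\frac{((q+1)M-K)^{qm-1-t}}{(qm-1-t)!\,(m+t)!}C(x,t)\Biggr];\end{aligned}$$ and, for $n=0,\dots,l-2$ and $\max(K-(n+1)M,0)\le x<K-nM$, $$g(x)=e^{-\lambda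 x}\sum_{r=0}^{m-1}\frac{\alpha_r}{r!}\Biggl[\sum_{q=0}^{n}\lambda^{(q+1)m-r}e^{-\lambda Mq}\frac{(qM+x-K)^{(q+1)m-r-1}}{((q+1)m-r-1)!}-\sum_{q=1}^{n}\lambda^{qm}e^{-\lambda Mq}\frac{(qM+x-K)^{qm-1}}{(qm-1)!}\Biggr].$$ **Claim 2.** The matrix $I+A$ is invertible, so that $\alpha$ is the only solution of $(I+A)\alpha=\mathbf 1$, if and only if $$\sum_{n=0}^{m-1}\frac{(1-\lambda(K-M))^n}{n!}\neq 0.$$ -/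

import Mathlib

open MeasureTheory ProbabilityTheory Filter Topology

universe u

namespace OnOff

noncomputable section

/-! ### The storage process of the on-off policy -/

/-- Transmit power of the on-off policy when the stored energy is `b`: `M` if `b > M`, and `0`
otherwise. -/
def txPower (M b : ℝ) : ℝ := if M < b then M else 0

/-- One step of the storage equation: stored energy `b`, harvested energy `x`, capacity `K`. -/
def step (M K b x : ℝ) : ℝ := min (b - txPower M b + x) K

/-- `B` is a storage process of the on-off policy on the probability space `(Ω, P)`, driven by the
i.i.d. energy harvesting process `X` with Gamma distribution of shape `m` and rate `lam`, and
started from an arbitrary `[0, K]`-valued `B 0` that is independent of `X`. -/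
structure IsStorageProcess {Ω : Type u} [MeasurableSpace Ω] (P : Measure Ω) (m : ℕ)
    (lam M K : ℝ) (B X : ℕ → Ω → ℝ) : Prop where
  measurable_harvest : ∀ i, Measurable (X i)
  harvest_law : ∀ i, P.map (X i) = gammaMeasure (m : ℝ) lam
  harvest_indep : iIndepFun X P
  measurable_init : Measurable (B 0)
  init_mem : ∀ᵐ ω ∂P, B 0 ω ∈ Set.Icc 0 K
  init_indep : IndepFun (B 0) (fun ω i => X i ω) P
  storage_eq : ∀ i ω, B (i + 1) ω = step M K (B i ω) (X i ω)

/-- `π` is a stationary law of the storage process: if `B(i)` has law `π` and `X(i)` is independent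
of `B(i)`, then `B(i+1)` has law `π`. -/
def IsStationaryLaw (m : ℕ) (lam M K : ℝ) (π : Measure ℝ) : Prop :=
  (π.prod (gammaMeasure (m : ℝ) lam)).map (fun p : ℝ × ℝ => step M K p.1 p.2) = π

/-- `π` is the limiting law of the storage process: it is a stationary probability law on `[0, K]`,
and for every initial distribution on `[0, K]` the law of `B(i)` converges to `π` in total
variation, that is, `P (B(i) ∈ s)` converges to `π s` uniformly over all Borel sets `s`. -/
def IsLimitingLaw (m : ℕ) (lam M K : ℝ) (π : Measure ℝ) : Prop :=
  IsProbabilityMeasure π ∧ π (Set.Icc 0 K)ᶜ = 0 ∧ IsStationaryLaw m lam M K π ∧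
    ∀ (Ω : Type u) [MeasurableSpace Ω] (P : Measure Ω) [IsProbabilityMeasure P]
      (B X : ℕ → Ω → ℝ), IsStorageProcess P m lam M K B X →
      TendstoUniformlyOn (fun (i : ℕ) (s : Set ℝ) => (P.map (B i)).real s) (fun s => π.real s)
        atTop {s | MeasurableSet s}

/-- The measure with density `g` on `[0, K)` and an atom of mass `p` at `K`. -/
def densityAtom (K : ℝ) (g : ℝ → ℝ) (p : ℝ) : Measure ℝ :=
  (volume.restrict (Set.Ico 0 K)).withDensity (fun x => ENNReal.ofReal (g x)) +
    ENNReal.ofReal p • Measure.dirac K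

/-! ### The explicit formulas -/

/-- Lower incomplete Gamma function `γ(n, z)` for a positive integer `n` and complex `z`. -/
def lowerGamma (n : ℕ) (z : ℂ) : ℂ :=
  ((n - 1).factorial : ℂ) *
    (1 - Complex.exp (-z) * ∑ i ∈ Finset.range n, z ^ i / (i.factorial : ℂ))

/-- `exp (j η_k)` with `η_k = 2 π k / m`. -/
def root (m k : ℕ) : ℂ := Complex.exp (Complex.I * ((2 * Real.pi * k / m : ℝ) : ℂ))

/-- The function `C(x, t)`. -/
def C (m : ℕ) (lam x : ℝ) (t : ℕ) : ℝ :=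
  x ^ (m + t) + 1 / (m : ℝ) * ∑ k ∈ Finset.range m,
    ((((lam : ℂ) * root m k) ^ (m + t))⁻¹ * Complex.exp ((lam : ℂ) * x * root m k) *
      lowerGamma (m + t + 1) ((lam : ℂ) * x * root m k)).re

/-- The density `g_{l-1}` on `[0, M)`. -/
def lowDensity (m l : ℕ) (lam M K : ℝ) (α : Fin m → ℝ) (x : ℝ) : ℝ :=
  Real.exp (-lam * x) * ∑ r : Fin m, α r / ((r : ℕ).factorial : ℝ) *
    ((∑ q ∈ Finset.range (l - 1), lam ^ ((q + 2) * m - r) * Real.exp (-lam * M * (q + 1)) *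
        ∑ t ∈ Finset.range ((q + 1) * m - r),
          ((q + 1) * M - K) ^ ((q + 1) * m - r - 1 - t) /
            ((((q + 1) * m - r - 1 - t).factorial : ℝ) * ((m + t).factorial : ℝ)) * C m lam x t)
      - ∑ q ∈ Finset.Icc 1 (l - 2), lam ^ ((q + 1) * m) * Real.exp (-lam * M * (q + 1)) *
        ∑ t ∈ Finset.range (q * m),
          ((q + 1) * M - K) ^ (q * m - 1 - t) /
            (((q * m - 1 - t).factorial : ℝ) * ((m + t).factorial : ℝ)) * C m lam x t)

/-- The density `g_n` on the stripe `[K - (n+1) M, K - n M)`, `0 ≤ n ≤ l - 2`. -/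
def stripeDensity (m : ℕ) (lam M K : ℝ) (α : Fin m → ℝ) (n : ℕ) (x : ℝ) : ℝ :=
  Real.exp (-lam * x) * ∑ r : Fin m, α r / ((r : ℕ).factorial : ℝ) *
    ((∑ q ∈ Finset.range (n + 1), lam ^ ((q + 1) * m - r) * Real.exp (-lam * M * q) *
        ((q * M + x - K) ^ ((q + 1) * m - r - 1) / (((q + 1) * m - r - 1).factorial : ℝ)))
      - ∑ q ∈ Finset.Icc 1 n, lam ^ (q * m) * Real.exp (-lam * M * q) *
        ((q * M + x - K) ^ (q * m - 1) / ((q * m - 1).factorial : ℝ)))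

/-- The limiting probability `π(K)` of a full buffer. -/
def fullProb (m : ℕ) (lam K : ℝ) (α : Fin m → ℝ) : ℝ :=
  Real.exp (-lam * K) * ∑ r : Fin m, α r / ((r : ℕ).factorial : ℝ)

/-- The function `F(t, s)`. -/
def F (m : ℕ) (lam M K : ℝ) (t s : ℕ) : ℝ :=
  ∑ b ∈ Finset.range (s + 1), (s.choose b : ℝ) * (K - M) ^ (s - b) *
    ((b.factorial : ℝ) * M ^ (m + t + b + 1) / ((m + t + b + 1).factorial : ℝ) +
      1 / (m : ℝ) * ∑ k ∈ Finset.range m,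
        (Complex.exp ((lam : ℂ) * M * root m k) * (((lam : ℂ) * root m k) ^ (m + t + b + 1))⁻¹ *
            lowerGamma (b + 1) ((lam : ℂ) * M * root m k)
          - (b.factorial : ℂ) * ∑ w ∈ Finset.range (m + t + 1),
              ((lam : ℂ) * root m k) ^ ((w : ℤ) - ((m : ℤ) + (t : ℤ))) *
                ((M : ℂ) ^ (w + b + 1) / ((w + b + 1).factorial : ℂ))).re)

/-- The numbers `ρ_k` (they depend on `t`). -/
def rho (m : ℕ) (lam M : ℝ) (t k : ℕ) : ℂ :=
  if k = 0 then (lam : ℂ) * M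
  else (root m k ^ (m + t))⁻¹ * (1 - root m k)⁻¹ *
    (1 - Complex.exp (-((lam : ℂ) * M * (1 - root m k))))

/-- The function `H(t)`. -/
def H (m : ℕ) (lam M : ℝ) (t : ℕ) : ℝ :=
  (lam ^ (m + t + 1))⁻¹ *
    ((lowerGamma (m + t + 1) ((lam : ℂ) * M)).re / ((m + t).factorial : ℝ) +
      1 / (m : ℝ) * ∑ k ∈ Finset.range m,
        (rho m lam M t k - ∑ w ∈ Finset.range (m + t + 1),
          root m k ^ ((w : ℤ) - ((m : ℤ) + (t : ℤ))) / (w.factorial : ℂ) *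
            lowerGamma (w + 1) ((lam : ℂ) * M)).re)

/-- The `m × m` coefficient matrix `A`. -/
def coeffMatrix (m l : ℕ) (lam M K : ℝ) : Matrix (Fin m) (Fin m) ℝ :=
  Matrix.of fun s r : Fin m =>
    1 / ((r : ℕ).factorial : ℝ) *
      ((∑ q ∈ Finset.range (l - 1), lam ^ ((q + 2) * m - r) * Real.exp (-lam * M * (q + 1)) *
          ∑ t ∈ Finset.range ((q + 1) * m - r),
            ((q + 1) * M - K) ^ ((q + 1) * m - r - 1 - t) /
              (((q + 1) * m - r - 1 - t).factorial : ℝ) *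
              (H m lam M t - lam ^ (s : ℕ) * F m lam M K t s))
        - (∑ q ∈ Finset.Icc 1 (l - 2), lam ^ ((q + 1) * m) * Real.exp (-lam * M * (q + 1)) *
          ∑ t ∈ Finset.range (q * m),
            ((q + 1) * M - K) ^ (q * m - 1 - t) / ((q * m - 1 - t).factorial : ℝ) *
              (H m lam M t - lam ^ (s : ℕ) * F m lam M K t s))
        + (∑ q ∈ Finset.range (l - 1), Real.exp (-lam * M * (q + 1)) *
          ∑ t ∈ Finset.Ico (q * m) ((q + 1) * m - r),
            lam ^ t * ((q + 1) * M - K) ^ t / (t.factorial : ℝ))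
        + lam ^ (s : ℕ) * K ^ (s : ℕ) *
          ∑ q ∈ Finset.range (l - 1), lam ^ (q * m) * Real.exp (-lam * M * (q + 1)) *
            ∑ t ∈ Finset.range ((s : ℕ) + 1),
              ((s : ℕ).choose t : ℝ) * (K ^ t)⁻¹ * (t.factorial : ℝ) *
                (lam ^ (m - r) * ((q + 1) * M - K) ^ ((q + 1) * m - r + t) /
                    (((q + 1) * m - r + t).factorial : ℝ)
                  - ((q + 1) * M - K) ^ (q * m + t) / ((q * m + t).factorial : ℝ)))

end

end OnOff

namespace OnOff

open scoped Nat

/-! A coefficient vector `α` determines a signed law on `[0, K]`: the density `dens` together with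
the atom `fullProb`. The argument shows that this law is stationary as soon as `α` satisfies `m`
linear equations, solves these by a rank argument, and obtains positivity and convergence from
Doeblin's contraction.

Given that the energy after transmission is `z`, the next level before truncation at `K` has density
`erl m lam (x - z)`, that is `exp (-lam x) exp (lam z)` times a polynomial in `x - z`, cut off at `z
≤ x`. Without the cut-off, expanding the polynomial about `K` makes the image density depend on the
current law only through `m` exponential moments (`expMoment`); the cut-off adds a correction by
truncated powers (`erl_expand`). Truncated powers are closed under convolution, and one step moves a
break point `K - q M` to `K - (q + 1) M` while raising the degree by `m`; this telescopes in
`profile_eq`. Below `M` the buffer does not transmit, and the balance equation becomes a renewal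
equation solved by the series `∑ lam ^ (j m) x ^ (n + j m) / (n + j m)!`. A roots-of-unity filter
sums this series as `cyc`, which is the origin of the incomplete Gamma functions in `C`, `F` and
`H`.

Consequently one step changes the law of `α` only through the vector `defect`, the difference
between `α` and the exponential moments of its own law (`lawInt_sub_lawInt_stepOp`). The matrix is
such that `(1 + A) α = defect α + mass α • 1` (`coeffMatrix_eq`, `mulVec_eq`).

Testing the one-step identity with the constant function `1` gives a nonzero vector `nullVec`
orthogonal to every defect (`sum_defect`). So the defect map is not surjective, hence not injective,
and some `α ≠ 0` has zero defect. A harvest of at least `K` fills the buffer from any state, so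
iterates of the transition operator flatten geometrically (`OscLE.stepOp`). A zero-defect law of
mass `0` therefore integrates everything to `0`, and `α`, being its moment vector, would vanish.
Hence the mass is nonzero and can be normalised to `1`. The same contraction gives positivity and
convergence in total variation.

For the determinant, pairing with `nullVec` gives `nullVec ⬝ (1 + A) α = mass α * (nullVec ⬝ 1)`. If
`nullVec ⬝ 1 ≠ 0`, a kernel vector has mass and defect zero, so it is zero; if `nullVec ⬝ 1 = 0`,
then `nullVec` is a left null vector. The binomial theorem evaluates `nullVec ⬝ 1` as the sum in
Claim 2. -/

/-! ### Roots-of-unity filter and the lacunary exponential series -/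

theorem root_eq (m k : ℕ) : root m k = Complex.exp (2 * Real.pi * Complex.I / m) ^ k := by
  rw [root, ← Complex.exp_nat_mul]
  congr 1
  push_cast
  ring

theorem root_ne_zero (m k : ℕ) : root m k ≠ 0 := Complex.exp_ne_zero _

theorem root_pow_self {m : ℕ} (hm : m ≠ 0) (k : ℕ) : root m k ^ m = 1 := by
  rw [root_eq, ← pow_mul, mul_comm k m, pow_mul, (Complex.isPrimitiveRoot_exp m hm).pow_eq_one,
    one_pow]

theorem root_zero (m : ℕ) : root m 0 = 1 := by simp [root]

theorem root_ne_one {m k : ℕ} (hk : k ≠ 0) (hkm : k < m) : root m k ≠ 1 := by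
  rw [root_eq]
  exact (Complex.isPrimitiveRoot_exp m (by omega)).pow_ne_one_of_pos_of_lt hk hkm

theorem sum_root_pow {m j : ℕ} (h0 : j ≠ 0) (hj : j < m) :
    ∑ k ∈ Finset.range m, root m k ^ j = 0 := by
  have hp := Complex.isPrimitiveRoot_exp m (by omega)
  simp_rw [root_eq, ← pow_mul, mul_comm _ j, pow_mul]
  set z := Complex.exp (2 * Real.pi * Complex.I / m) with hz
  have h1 : z ^ j ≠ 1 := hp.pow_ne_one_of_pos_of_lt h0 hj
  have h2 : (z ^ j) ^ m = 1 := by rw [← pow_mul, mul_comm, pow_mul, hp.pow_eq_one, one_pow]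
  have h3 := geom_sum_mul (z ^ j) m
  rw [h2, sub_self] at h3
  exact (mul_eq_zero.mp h3).resolve_right (sub_ne_zero.mpr h1)

noncomputable section

/-- Remainder of the exponential series after the term of degree `n`. -/
def expRem (n : ℕ) (z : ℂ) : ℂ := Complex.exp z - ∑ w ∈ Finset.range (n + 1), z ^ w / (w ! : ℂ)

/-- `∑ j, λ ^ (j m) x ^ (n + j m) / (n + j m)!`, in closed form. -/
def cyc (m : ℕ) (lam : ℝ) (n : ℕ) (x : ℝ) : ℝ :=
  x ^ n / (n ! : ℝ) + 1 / (m : ℝ) * ∑ k ∈ Finset.range m,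
    ((((lam : ℂ) * root m k) ^ n)⁻¹ * expRem n ((lam : ℂ) * x * root m k)).re

end

/-- Turns the incomplete Gamma values of the statement into Taylor remainders of `exp`, for which
differentiation merely lowers the order. -/
theorem exp_mul_lowerGamma (n : ℕ) (z : ℂ) :
    Complex.exp z * lowerGamma (n + 1) z = (n ! : ℂ) * expRem n z := by
  rw [lowerGamma, expRem, Nat.add_sub_cancel]
  have : Complex.exp z * Complex.exp (-z) = 1 := by rw [← Complex.exp_add]; simp
  linear_combination (-(n ! : ℂ) * ∑ i ∈ Finset.range (n + 1), z ^ i / (i ! : ℂ)) * this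

theorem C_eq (m : ℕ) (lam x : ℝ) (t : ℕ) :
    C m lam x t = ((m + t)! : ℝ) * cyc m lam (m + t) x := by
  have hf : ((m + t)! : ℝ) ≠ 0 := by positivity
  rw [C, cyc, mul_add, mul_div_cancel₀ _ hf]
  congr 1
  rw [mul_left_comm]
  congr 1
  rw [Finset.mul_sum]
  refine Finset.sum_congr rfl fun k _ => ?_
  rw [mul_assoc, exp_mul_lowerGamma, mul_left_comm, ← Complex.ofReal_natCast, Complex.re_ofReal_mul]

theorem expRem_at_zero (n : ℕ) : expRem n 0 = 0 := by
  simp [expRem, Finset.sum_range_succ']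

theorem hasDerivAt_expRem (n : ℕ) (z : ℂ) : HasDerivAt (expRem (n + 1)) (expRem n z) z := by
  have h : HasDerivAt (fun z : ℂ => ∑ w ∈ Finset.range (n + 2), z ^ w / (w ! : ℂ))
      (∑ w ∈ Finset.range (n + 2), (w * z ^ (w - 1)) / (w ! : ℂ)) z :=
    HasDerivAt.fun_sum fun w _ => (hasDerivAt_pow w z).div_const _
  refine ((Complex.hasDerivAt_exp z).sub h).congr_deriv ?_
  rw [expRem, Finset.sum_range_succ' _ (n + 1)]
  have h0 : ((0 : ℕ) : ℂ) * z ^ (0 - 1) / (0 ! : ℂ) = 0 := by simp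
  rw [h0, add_zero]
  congr 1
  refine Finset.sum_congr rfl fun w _ => ?_
  have h1 : (w ! : ℂ) ≠ 0 := by exact_mod_cast (Nat.factorial_pos w).ne'
  have h2 : ((w : ℂ) + 1) ≠ 0 := by exact_mod_cast Nat.succ_ne_zero w
  rw [Nat.factorial_succ]
  push_cast
  field_simp

/-- Every term of the series drops one degree. Together with the vanishing at `0`, this makes `cyc`
a chain of iterated antiderivatives, which is what convolution with powers needs. -/
theorem hasDerivAt_cyc {m : ℕ} {lam : ℝ} (hlam : lam ≠ 0) (n : ℕ) (x : ℝ) :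
    HasDerivAt (cyc m lam (n + 1)) (cyc m lam n x) x := by
  have hl : (lam : ℂ) ≠ 0 := by exact_mod_cast hlam
  refine HasDerivAt.add ?_ (HasDerivAt.const_mul _ (HasDerivAt.fun_sum fun k _ => ?_))
  · have := (hasDerivAt_pow (n + 1) x).div_const ((n + 1)! : ℝ)
    refine this.congr_deriv ?_
    rw [Nat.factorial_succ, Nat.add_sub_cancel]
    push_cast
    field_simp
  · have h1 : HasDerivAt (fun z : ℂ => (lam : ℂ) * z * root m k) ((lam : ℂ) * root m k) (x : ℂ) := by
      simpa using ((hasDerivAt_id (x : ℂ)).const_mul (lam : ℂ)).mul_const (root m k)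
    have h2 := ((hasDerivAt_expRem n _).comp (x : ℂ) h1).const_mul
      ((((lam : ℂ) * root m k) ^ (n + 1))⁻¹)
    refine h2.real_of_complex.congr_deriv ?_
    have := root_ne_zero m k
    rw [pow_succ]
    congr 1
    field_simp

theorem cyc_succ_zero (m : ℕ) (lam : ℝ) (n : ℕ) : cyc m lam (n + 1) 0 = 0 := by
  simp [cyc, expRem_at_zero]

/-- The filter itself: after cancellation only `root m k ^ (j + 1)` depends on `k`, and its average
over all `k` is `1` if `j + 1 = m` and `0` otherwise. -/
theorem avg_root_pow_re {m n j : ℕ} (hj : j < m) (hm : m ≠ 0) (lam x : ℝ) (hlam : lam ≠ 0) :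
    1 / (m : ℝ) * ∑ k ∈ Finset.range m,
      ((((lam : ℂ) * root m k) ^ n)⁻¹ * (((lam : ℂ) * x * root m k) ^ (n + (j + 1)) /
        ((n + (j + 1))! : ℂ))).re =
      if j + 1 = m then lam ^ m * x ^ (n + m) / ((n + m)! : ℝ) else 0 := by
  have hl : (lam : ℂ) ≠ 0 := by exact_mod_cast hlam
  have hm' : (m : ℝ) ≠ 0 := by exact_mod_cast hm
  have key : ∀ k, (((lam : ℂ) * root m k) ^ n)⁻¹ * (((lam : ℂ) * x * root m k) ^ (n + (j + 1)) /
        ((n + (j + 1))! : ℂ)) =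
      ((lam ^ (j + 1) * x ^ (n + (j + 1)) / ((n + (j + 1))! : ℝ) : ℝ) : ℂ) *
        root m k ^ (j + 1) := by
    intro k
    have := root_ne_zero m k
    push_cast
    rw [mul_pow, mul_pow, mul_pow, pow_add (lam : ℂ), pow_add (root m k)]
    field_simp
  rw [Finset.sum_congr rfl fun k _ => congrArg Complex.re (key k), ← Complex.re_sum, ← Finset.mul_sum, Complex.re_ofReal_mul]
  split_ifs with h
  · subst h
    rw [Finset.sum_congr rfl fun k _ => root_pow_self hm k, Finset.sum_const, Finset.card_range, nsmul_eq_mul, mul_one, Complex.natCast_re]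
    field_simp
  · rw [sum_root_pow (by omega) (by omega)]
    simp

theorem expRem_add (n j : ℕ) (z : ℂ) :
    expRem n z = expRem (n + j) z + ∑ i ∈ Finset.range j, z ^ (n + (i + 1)) / ((n + (i + 1))! : ℂ) := by
  rw [expRem, expRem, show n + j + 1 = n + 1 + j by ring, Finset.sum_range_add _ (n + 1) j]
  have : ∑ i ∈ Finset.range j, z ^ (n + (i + 1)) / ((n + (i + 1))! : ℂ) =
      ∑ i ∈ Finset.range j, z ^ (n + 1 + i) / ((n + 1 + i)! : ℂ) :=
    Finset.sum_congr rfl fun i _ => by rw [show n + (i + 1) = n + 1 + i by ring]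
  rw [this]
  ring

/-- Dropping the leading term of the series leaves `lam ^ m` times the series of order `n + m`. This
is the renewal equation on `[0, M)` in algebraic form. -/
theorem cyc_add_period {m : ℕ} (hm : m ≠ 0) {lam : ℝ} (hlam : lam ≠ 0) (n : ℕ) (x : ℝ) :
    lam ^ m * cyc m lam (n + m) x = cyc m lam n x - x ^ n / (n ! : ℝ) := by
  have h : ∀ k, (((lam : ℂ) * root m k) ^ n)⁻¹ * expRem n ((lam : ℂ) * x * root m k) =
      ((lam ^ m : ℝ) : ℂ) * ((((lam : ℂ) * root m k) ^ (n + m))⁻¹ *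
        expRem (n + m) ((lam : ℂ) * x * root m k)) +
      ∑ i ∈ Finset.range m, (((lam : ℂ) * root m k) ^ n)⁻¹ *
        (((lam : ℂ) * x * root m k) ^ (n + (i + 1)) / ((n + (i + 1))! : ℂ)) := by
    intro k
    have hl : (lam : ℂ) ≠ 0 := by exact_mod_cast hlam
    have := root_ne_zero m k
    rw [expRem_add n m, mul_add, Finset.mul_sum, pow_add, mul_pow _ _ m, root_pow_self hm]
    congr 1
    push_cast
    field_simp
  have h2 : 1 / (m : ℝ) * ∑ k ∈ Finset.range m, (∑ i ∈ Finset.range m,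
      (((lam : ℂ) * root m k) ^ n)⁻¹ *
        (((lam : ℂ) * x * root m k) ^ (n + (i + 1)) / ((n + (i + 1))! : ℂ))).re =
      lam ^ m * x ^ (n + m) / ((n + m)! : ℝ) := by
    simp_rw [Complex.re_sum]
    rw [Finset.sum_comm, Finset.mul_sum,
      Finset.sum_congr rfl fun j hj => avg_root_pow_re (Finset.mem_range.mp hj) hm lam x hlam,
      Finset.sum_eq_single (m - 1)]
    · rw [if_pos (by omega)]
    · intro b _ hb
      rw [if_neg (by omega)]
    · intro hb
      exact absurd (Finset.mem_range.mpr (by omega)) hb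
  simp only [cyc]
  simp_rw [h, Complex.add_re, Complex.re_ofReal_mul, Finset.sum_add_distrib, mul_add]
  rw [h2, ← Finset.mul_sum]
  ring

/-- Convolution of a chain of antiderivatives with a power. -/
theorem integral_chain_mul_pow {Φ : ℕ → ℝ → ℝ} {a : ℝ}
    (hd : ∀ n x, HasDerivAt (Φ (n + 1)) (Φ n x) x) (h0 : ∀ n, Φ (n + 1) a = 0) (y : ℝ) (j n : ℕ)
    (hc : Continuous (Φ n)) :
    ∫ b in a..y, Φ n b * ((y - b) ^ j / (j ! : ℝ)) = Φ (n + j + 1) y := by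
  induction j generalizing n with
  | zero =>
    simp only [pow_zero, Nat.factorial_zero, Nat.cast_one, div_one, mul_one, add_zero]
    rw [intervalIntegral.integral_eq_sub_of_hasDerivAt (fun x _ => hd n x) (hc.intervalIntegrable _ _),
      h0, sub_zero]
  | succ j ih =>
    have hc' : Continuous (Φ (n + 1)) :=
      continuous_iff_continuousAt.mpr fun x => (hd n x).continuousAt
    have hv : ∀ b : ℝ, HasDerivAt (fun b : ℝ => (y - b) ^ (j + 1) / ((j + 1)! : ℝ))
        (-((y - b) ^ j / (j ! : ℝ))) b := by
      intro b
      have := (((hasDerivAt_id b).const_sub y).pow (j + 1)).div_const ((j + 1)! : ℝ)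
      refine this.congr_deriv ?_
      rw [Nat.factorial_succ]
      push_cast
      simp only [id]
      field_simp
    -- Integration by parts trades one degree of the power for one step along the chain; the
    -- boundary terms vanish, at `y` because of the power and at `a` because of `h0`.
    have h1 := intervalIntegral.integral_mul_deriv_eq_deriv_mul (a := a) (b := y)
      (v := Φ (n + 1)) (v' := Φ n) (u := fun b : ℝ => (y - b) ^ (j + 1) / ((j + 1)! : ℝ))
      (u' := fun b => -((y - b) ^ j / (j ! : ℝ)))
      (fun x _ => hv x) (fun x _ => hd n x)
      ((by fun_prop : Continuous fun b : ℝ => -((y - b) ^ j / (j ! : ℝ))).intervalIntegrable _ _)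
      (hc.intervalIntegrable _ _)
    have h2 := ih (n + 1) hc'
    simp_rw [mul_comm (Φ n _)]
    rw [h1]
    simp_rw [neg_mul, mul_comm _ (Φ (n + 1) _)]
    rw [intervalIntegral.integral_neg, h2, h0, sub_self, show n + (j + 1) + 1 = n + 1 + j + 1 by ring]
    simp

theorem continuous_cyc {m : ℕ} {lam : ℝ} (n : ℕ) : Continuous (cyc m lam n) := by
  unfold cyc expRem
  fun_prop

theorem integral_cyc_mul_pow {m : ℕ} {lam : ℝ} (hlam : lam ≠ 0) (n j : ℕ) (y : ℝ) :
    ∫ b in (0 : ℝ)..y, cyc m lam n b * ((y - b) ^ j / (j ! : ℝ)) = cyc m lam (n + j + 1) y :=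
  integral_chain_mul_pow (fun n x => hasDerivAt_cyc hlam n x) (cyc_succ_zero m lam) y j n
    (continuous_cyc n)

theorem hasDerivAt_pow_div_factorial (c : ℝ) (n : ℕ) (x : ℝ) :
    HasDerivAt (fun x : ℝ => (x - c) ^ (n + 1) / ((n + 1)! : ℝ)) ((x - c) ^ n / (n ! : ℝ)) x := by
  have := (((hasDerivAt_id x).sub_const c).pow (n + 1)).div_const ((n + 1)! : ℝ)
  refine this.congr_deriv ?_
  rw [Nat.factorial_succ]
  push_cast
  simp only [id]
  field_simp

theorem integral_pow_mul_pow (c y : ℝ) (i j : ℕ) :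
    ∫ b in c..y, (b - c) ^ i / (i ! : ℝ) * ((y - b) ^ j / (j ! : ℝ)) =
      (y - c) ^ (i + j + 1) / ((i + j + 1)! : ℝ) :=
  integral_chain_mul_pow (Φ := fun n x => (x - c) ^ n / (n ! : ℝ))
    (fun n x => hasDerivAt_pow_div_factorial c n x) (fun n => by simp) y j i (by fun_prop)

end OnOff

/-! ### The numbers F and H as integrals -/

namespace OnOff

open scoped Nat

theorem F_eq (m : ℕ) {lam : ℝ} (hlam : lam ≠ 0) (M K : ℝ) (t s : ℕ) :
    F m lam M K t s = ∑ b ∈ Finset.range (s + 1), (s.choose b : ℝ) * (K - M) ^ (s - b) *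
      ((b ! : ℝ) * cyc m lam (m + t + b + 1) M) := by
  have hl : (lam : ℂ) ≠ 0 := by exact_mod_cast hlam
  refine Finset.sum_congr rfl fun b _ => ?_
  congr 1
  rw [cyc, mul_add, ← mul_div_assoc, mul_left_comm (b ! : ℝ), Finset.mul_sum (a := (b ! : ℝ))]
  congr 2
  refine Finset.sum_congr rfl fun k _ => ?_
  rw [← Complex.re_ofReal_mul]
  congr 1
  have hr := root_ne_zero m k
  have h1 := exp_mul_lowerGamma b ((lam : ℂ) * M * root m k)
  -- The remainder of order `b` exceeds that of order `m + t + b + 1` by exactly the finite sum over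
  -- `w` subtracted in `F`.
  rw [expRem_add b (m + t + 1), show b + (m + t + 1) = m + t + b + 1 by ring] at h1
  have h2 : ∀ w ∈ Finset.range (m + t + 1),
      ((lam : ℂ) * root m k) ^ ((w : ℤ) - ((m : ℤ) + (t : ℤ))) *
                ((M : ℂ) ^ (w + b + 1) / ((w + b + 1)! : ℂ)) =
      (((lam : ℂ) * root m k) ^ (m + t + b + 1))⁻¹ *
        (((lam : ℂ) * M * root m k) ^ (b + (w + 1)) / ((b + (w + 1))! : ℂ)) := by
    intro w _
    have hz : (lam : ℂ) * root m k ≠ 0 := mul_ne_zero hl hr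
    rw [show b + (w + 1) = w + b + 1 by ring, zpow_sub₀ hz, zpow_natCast,
      show ((m : ℤ) + (t : ℤ)) = ((m + t : ℕ) : ℤ) by push_cast; rfl, zpow_natCast,
      mul_right_comm (lam : ℂ), mul_pow _ (M : ℂ), show m + t + b + 1 = (m + t) + (b + 1) by ring,
      show w + b + 1 = w + (b + 1) by ring, pow_add _ (m + t), pow_add _ w]
    field_simp
    ring
  rw [Finset.sum_congr rfl h2, ← Finset.mul_sum, mul_right_comm, h1]
  push_cast
  ring

/-- Writing `K - x = (M - x) + (K - M)` reduces the integral to convolutions of `cyc` with powers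
evaluated at `M`; the binomial sum in `F` is this expansion. -/
theorem integral_pow_mul_cyc {m : ℕ} {lam : ℝ} (hlam : lam ≠ 0) (M K : ℝ) (t s : ℕ) :
    ∫ x in (0 : ℝ)..M, (K - x) ^ s * cyc m lam (m + t) x = F m lam M K t s := by
  rw [F_eq m hlam]
  have h : ∀ x, (K - x) ^ s * cyc m lam (m + t) x = ∑ b ∈ Finset.range (s + 1),
      (s.choose b : ℝ) * (K - M) ^ (s - b) * ((b ! : ℝ) *
        (cyc m lam (m + t) x * ((M - x) ^ b / (b ! : ℝ)))) := by
    intro x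
    rw [show K - x = (M - x) + (K - M) by ring, add_pow, Finset.sum_mul]
    refine Finset.sum_congr rfl fun b _ => ?_
    have : (b ! : ℝ) ≠ 0 := by positivity
    field_simp
  simp_rw [h]
  have hc := continuous_cyc (m := m) (lam := lam) (m + t)
  rw [intervalIntegral.integral_finsetSum fun b _ =>
    (by fun_prop : Continuous _).intervalIntegrable _ _]
  refine Finset.sum_congr rfl fun b _ => ?_
  rw [intervalIntegral.integral_const_mul, intervalIntegral.integral_const_mul,
    integral_cyc_mul_pow hlam]

theorem hasDerivAt_expRem_self (n : ℕ) (z : ℂ) :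
    HasDerivAt (expRem n) (expRem n z + z ^ n / (n ! : ℂ)) z := by
  cases n with
  | zero =>
    have h : expRem 0 = fun z => Complex.exp z - 1 := by
      funext z
      simp [expRem]
    rw [h]
    refine ((Complex.hasDerivAt_exp z).sub_const 1).congr_deriv ?_
    simp
  | succ n =>
    refine (hasDerivAt_expRem n z).congr_deriv ?_
    rw [expRem, expRem, Finset.sum_range_succ _ (n + 1)]
    ring

theorem hasDerivAt_lowerGamma (n : ℕ) (z : ℂ) :
    HasDerivAt (lowerGamma (n + 1)) (Complex.exp (-z) * z ^ n) z := by
  have h : lowerGamma (n + 1) = fun z => Complex.exp (-z) * ((n ! : ℂ) * expRem n z) := by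
    funext z
    rw [← exp_mul_lowerGamma, ← mul_assoc, ← Complex.exp_add]
    simp
  rw [h]
  have h1 : HasDerivAt (fun z => Complex.exp (-z)) (-Complex.exp (-z)) z := by
    exact ((Complex.hasDerivAt_exp (-z)).comp z (hasDerivAt_neg z)).congr_deriv (by ring)
  refine (h1.mul ((hasDerivAt_expRem_self n z).const_mul (n ! : ℂ))).congr_deriv ?_
  have : (n ! : ℂ) ≠ 0 := by exact_mod_cast (Nat.factorial_pos n).ne'
  field_simp
  ring

theorem lowerGamma_succ_zero (n : ℕ) : lowerGamma (n + 1) 0 = 0 := by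
  simp [lowerGamma, Finset.sum_range_succ']

/-- The numbers `rho`, as functions of `M`, integrate `exp (-lam x (1 - root m k))` up to a factor.
For `k = 0` the root is `1`, the integrand is constant, and dividing by `1 - root m k` is
impossible, hence the separate case. -/
theorem hasDerivAt_rho {m k : ℕ} (hk : k < m) (lam : ℝ) (t : ℕ) (x : ℝ) :
    HasDerivAt (fun z : ℂ => if k = 0 then (lam : ℂ) * z
      else (root m k ^ (m + t))⁻¹ * (1 - root m k)⁻¹ *
        (1 - Complex.exp (-((lam : ℂ) * z * (1 - root m k)))))
      ((lam : ℂ) * (root m k ^ (m + t))⁻¹ * (Complex.exp (-((lam : ℂ) * x)) *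
        Complex.exp ((lam : ℂ) * x * root m k))) x := by
  split_ifs with h
  · subst h
    refine ((hasDerivAt_id (x : ℂ)).const_mul (lam : ℂ)).congr_deriv ?_
    rw [root_zero, ← Complex.exp_add]
    simp
  · have h1 : (1 - root m k) ≠ 0 := sub_ne_zero.mpr (root_ne_one h hk).symm
    have h2 : HasDerivAt (fun z : ℂ => -((lam : ℂ) * z * (1 - root m k)))
        (-((lam : ℂ) * (1 - root m k))) (x : ℂ) := by
      exact ((((hasDerivAt_id (x : ℂ)).const_mul (lam : ℂ)).mul_const (1 - root m k)).neg).congr_deriv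
        (by ring)
    refine (((((Complex.hasDerivAt_exp _).comp (x : ℂ) h2).const_sub 1).const_mul _)).congr_deriv ?_
    rw [← Complex.exp_add, show -((lam : ℂ) * x * (1 - root m k)) =
      -((lam : ℂ) * x) + (lam : ℂ) * x * root m k by ring]
    field_simp

theorem hasDerivAt_H (m : ℕ) {lam : ℝ} (hlam : lam ≠ 0) (t : ℕ) (x : ℝ) :
    HasDerivAt (fun x => H m lam x t) (Real.exp (-lam * x) * cyc m lam (m + t) x) x := by
  have hl : (lam : ℂ) ≠ 0 := by exact_mod_cast hlam
  have hmul : HasDerivAt (fun z : ℂ => (lam : ℂ) * z) (lam : ℂ) (x : ℂ) := by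
    simpa using (hasDerivAt_id (x : ℂ)).const_mul (lam : ℂ)
  have hg : ∀ n, HasDerivAt (fun z : ℂ => lowerGamma (n + 1) ((lam : ℂ) * z))
      (Complex.exp (-((lam : ℂ) * x)) * ((lam : ℂ) * x) ^ n * lam) (x : ℂ) := fun n =>
    (hasDerivAt_lowerGamma n _).comp (x : ℂ) hmul
  refine HasDerivAt.congr_deriv (HasDerivAt.const_mul _ (HasDerivAt.add
    ((hg (m + t)).real_of_complex.div_const _)
    (HasDerivAt.const_mul _ (HasDerivAt.fun_sum fun k hk => HasDerivAt.real_of_complex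
      (HasDerivAt.sub (hasDerivAt_rho (Finset.mem_range.mp hk) lam t x)
        (HasDerivAt.fun_sum fun w _ => (hg w).const_mul _)))))) ?_
  have he : Complex.exp (-((lam : ℂ) * x)) = ((Real.exp (-lam * x) : ℝ) : ℂ) := by
    push_cast
    rw [neg_mul]
  have h1 : (Complex.exp (-((lam : ℂ) * x)) * ((lam : ℂ) * x) ^ (m + t) * lam).re =
      Real.exp (-lam * x) * (lam * x) ^ (m + t) * lam := by
    rw [he, ← Complex.ofReal_mul, ← Complex.ofReal_pow, ← Complex.ofReal_mul, ← Complex.ofReal_mul,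
      Complex.ofReal_re]
  rw [h1, cyc, mul_add, mul_add]
  congr 1
  · rw [mul_pow, pow_succ]
    field_simp
  · simp only [Finset.mul_sum]
    refine Finset.sum_congr rfl fun k _ => ?_
    have hr := root_ne_zero m k
    have hz : (lam : ℂ) * root m k ≠ 0 := mul_ne_zero hl hr
    have h2 : ∀ w ∈ Finset.range (m + t + 1),
        ((lam : ℂ) ^ (m + t + 1))⁻¹ * (root m k ^ ((w : ℤ) - ((m : ℤ) + (t : ℤ))) / (w ! : ℂ) *
          (Complex.exp (-((lam : ℂ) * x)) * ((lam : ℂ) * x) ^ w * lam)) =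
        Complex.exp (-((lam : ℂ) * x)) * ((((lam : ℂ) * root m k) ^ (m + t))⁻¹ *
          (((lam : ℂ) * x * root m k) ^ w / (w ! : ℂ))) := by
      intro w _
      rw [zpow_sub₀ hr, zpow_natCast, show ((m : ℤ) + (t : ℤ)) = ((m + t : ℕ) : ℤ) by push_cast; rfl,
        zpow_natCast, mul_pow _ (root m k) w, mul_pow _ (root m k) (m + t), pow_succ]
      field_simp
    have h3 : (lam ^ (m + t + 1))⁻¹ *
        ((lam : ℂ) * (root m k ^ (m + t))⁻¹ * (Complex.exp (-((lam : ℂ) * x)) *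
          Complex.exp ((lam : ℂ) * x * root m k)) - ∑ w ∈ Finset.range (m + t + 1),
            root m k ^ ((w : ℤ) - ((m : ℤ) + (t : ℤ))) / (w ! : ℂ) *
              (Complex.exp (-((lam : ℂ) * x)) * ((lam : ℂ) * x) ^ w * lam)).re =
        Real.exp (-lam * x) * ((((lam : ℂ) * root m k) ^ (m + t))⁻¹ *
          expRem (m + t) ((lam : ℂ) * x * root m k)).re := by
      rw [← Complex.re_ofReal_mul, ← Complex.re_ofReal_mul, ← he]
      congr 1
      push_cast
      rw [mul_sub, Finset.mul_sum, Finset.sum_congr rfl h2, ← Finset.mul_sum, ← Finset.mul_sum, expRem,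
        mul_pow _ (root m k), pow_succ]
      field_simp
    linear_combination (1 / (m : ℝ)) * h3

theorem H_zero (m : ℕ) (lam : ℝ) (t : ℕ) : H m lam 0 t = 0 := by
  have h : ∀ k, rho m lam 0 t k = 0 := fun k => by simp [rho]
  simp [H, h, lowerGamma_succ_zero]

theorem integral_exp_mul_cyc (m : ℕ) {lam : ℝ} (hlam : lam ≠ 0) (M : ℝ) (t : ℕ) :
    ∫ x in (0 : ℝ)..M, Real.exp (-lam * x) * cyc m lam (m + t) x = H m lam M t := by
  have hc := continuous_cyc (m := m) (lam := lam) (m + t)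
  rw [intervalIntegral.integral_eq_sub_of_hasDerivAt (fun x _ => hasDerivAt_H m hlam t x)
    ((by fun_prop : Continuous _).intervalIntegrable _ _), H_zero, sub_zero]

/-! ### Truncated powers and their convolutions -/

noncomputable section

/-- The function `λ ^ n y ^ (n - 1) / (n - 1)!`. -/
def scaledPow (lam : ℝ) (n : ℕ) (y : ℝ) : ℝ := lam ^ n * y ^ (n - 1) / ((n - 1)! : ℝ)

/-- `scaledPow` restricted to negative arguments. -/
def negPow (lam : ℝ) (n : ℕ) (y : ℝ) : ℝ := if y < 0 then scaledPow lam n y else 0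

end

theorem continuous_scaledPow (lam : ℝ) (n : ℕ) : Continuous (scaledPow lam n) := by
  unfold scaledPow
  fun_prop

theorem scaledPow_conv (lam : ℝ) {n k : ℕ} (hn : 0 < n) (hk : 0 < k) (c y : ℝ) :
    ∫ b in c..y, scaledPow lam n (b - c) * scaledPow lam k (y - b) = scaledPow lam (n + k) (y - c) := by
  obtain ⟨n, rfl⟩ := Nat.exists_eq_add_of_lt hn
  obtain ⟨k, rfl⟩ := Nat.exists_eq_add_of_lt hk
  have h := integral_pow_mul_pow c y n k
  simp only [scaledPow, zero_add, Nat.add_sub_cancel]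
  have : ∀ b : ℝ, lam ^ (n + 1) * (b - c) ^ n / (n ! : ℝ) * (lam ^ (k + 1) * (y - b) ^ k / (k ! : ℝ)) =
      lam ^ (n + 1 + (k + 1)) * ((b - c) ^ n / (n ! : ℝ) * ((y - b) ^ k / (k ! : ℝ))) := by
    intro b
    rw [pow_add lam (n + 1)]
    ring
  simp_rw [this]
  rw [intervalIntegral.integral_const_mul, h, show n + 1 + (k + 1) - 1 = n + k + 1 by omega]
  ring

theorem scaledPow_add (lam : ℝ) {n : ℕ} (hn : 0 < n) (x d : ℝ) :
    scaledPow lam n (x + d) = lam ^ n * ∑ t ∈ Finset.range n,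
      d ^ (n - 1 - t) / ((n - 1 - t)! : ℝ) * (x ^ t / (t ! : ℝ)) := by
  obtain ⟨n, rfl⟩ := Nat.exists_eq_add_of_lt hn
  simp only [scaledPow, zero_add, Nat.add_sub_cancel]
  rw [mul_div_assoc, add_pow, Finset.sum_div]
  congr 1
  refine Finset.sum_congr rfl fun t ht => ?_
  have hle : t ≤ n := Nat.lt_succ_iff.mp (Finset.mem_range.mp ht)
  rw [Nat.cast_choose ℝ hle]
  have : (n ! : ℝ) ≠ 0 := by positivity
  field_simp

theorem integral_exp_mul_scaledPow (lam a c : ℝ) {n : ℕ} (hn : 0 < n) :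
    ∫ x in a..c, Real.exp (-lam * x) * scaledPow lam n (x - c) =
      -Real.exp (-lam * c) + Real.exp (-lam * a) * ∑ t ∈ Finset.range n,
        (lam * (a - c)) ^ t / (t ! : ℝ) := by
  obtain ⟨n, rfl⟩ := Nat.exists_eq_add_of_lt hn
  have hS : ∀ n (x : ℝ), HasDerivAt (fun x : ℝ => ∑ t ∈ Finset.range (n + 1),
      (lam * (x - c)) ^ t / (t ! : ℝ)) (lam * ∑ t ∈ Finset.range n, (lam * (x - c)) ^ t / (t ! : ℝ)) x := by
    intro n x
    induction n with
    | zero => simpa using hasDerivAt_const x (1 : ℝ)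
    | succ n ih =>
      simp_rw [Finset.sum_range_succ _ (n + 1)]
      have h := (((hasDerivAt_id x).sub_const c).const_mul lam).pow (n + 1) |>.div_const ((n + 1)! : ℝ)
      refine (ih.add h).congr_deriv ?_
      rw [Finset.sum_range_succ, mul_add, Nat.factorial_succ]
      push_cast
      simp only [id]
      field_simp
  have hE : ∀ x : ℝ, HasDerivAt (fun x : ℝ => -Real.exp (-lam * x)) (lam * Real.exp (-lam * x)) x := by
    intro x
    refine ((((hasDerivAt_id x).const_mul (-lam)).exp).neg).congr_deriv ?_
    simp only [id]
    ring
  -- Explicit antiderivative: on differentiating, the two exponential sums cancel except for the top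
  -- term. At `x = c` only the term `t = 0` survives.
  have hD : ∀ x : ℝ, HasDerivAt (fun x : ℝ => -Real.exp (-lam * x) * ∑ t ∈ Finset.range (n + 1),
      (lam * (x - c)) ^ t / (t ! : ℝ)) (Real.exp (-lam * x) * scaledPow lam (n + 1) (x - c)) x := by
    intro x
    refine ((hE x).mul (hS n x)).congr_deriv ?_
    rw [Finset.sum_range_succ, scaledPow, Nat.add_sub_cancel, mul_pow]
    ring
  have hc := continuous_scaledPow lam (n + 1)
  simp only [zero_add]
  rw [intervalIntegral.integral_eq_sub_of_hasDerivAt (fun x _ => hD x)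
    ((by fun_prop : Continuous _).intervalIntegrable _ _)]
  rw [Finset.sum_range_succ' _ n]
  simp

/-- Used with `a = M`, where `K + M - x` is the distance from `K` to the energy left after
transmitting at level `x`. The sign comes from reversing the limits to apply the convolution formula
for powers. -/
theorem integral_pow_mul_scaledPow (lam a c K : ℝ) {n : ℕ} (hn : 0 < n) (s : ℕ) :
    ∫ x in a..c, (K + a - x) ^ s * scaledPow lam n (x - c) =
      -(lam ^ n * ∑ t ∈ Finset.range (s + 1), (s.choose t : ℝ) * K ^ (s - t) * (t ! : ℝ) *
        ((a - c) ^ (n + t) / ((n + t)! : ℝ))) := by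
  obtain ⟨n, rfl⟩ := Nat.exists_eq_add_of_lt hn
  have h : ∀ x : ℝ, (K + a - x) ^ s * scaledPow lam (n + 1) (x - c) = ∑ t ∈ Finset.range (s + 1),
      lam ^ (n + 1) * ((s.choose t : ℝ) * K ^ (s - t) * (t ! : ℝ)) *
        ((x - c) ^ n / (n ! : ℝ) * ((a - x) ^ t / (t ! : ℝ))) := by
    intro x
    rw [show K + a - x = (a - x) + K by ring, add_pow, Finset.sum_mul]
    refine Finset.sum_congr rfl fun t _ => ?_
    rw [scaledPow, Nat.add_sub_cancel]
    have : (t ! : ℝ) ≠ 0 := by positivity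
    field_simp
  simp only [zero_add]
  simp_rw [h]
  rw [intervalIntegral.integral_finsetSum fun b _ =>
    (by fun_prop : Continuous _).intervalIntegrable _ _, Finset.mul_sum, ← Finset.sum_neg_distrib]
  refine Finset.sum_congr rfl fun t _ => ?_
  rw [intervalIntegral.integral_const_mul, intervalIntegral.integral_symm, integral_pow_mul_pow,
    show n + 1 + t = n + t + 1 by ring]
  ring

theorem integral_mul_negPow (lam : ℝ) (n : ℕ) {a c K : ℝ} (hac : a ≤ c) (hcK : c ≤ K) (v : ℝ → ℝ) :
    ∫ x in a..K, v x * negPow lam n (x - c) = ∫ x in a..c, v x * scaledPow lam n (x - c) := by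
  rw [intervalIntegral.integral_of_le hac, intervalIntegral.integral_of_le (hac.trans hcK),
    integral_Ioc_eq_integral_Ioo (y := c),
    setIntegral_eq_of_subset_of_forall_sdiff_eq_zero measurableSet_Ioc
      (s := Set.Ioo a c) (fun x hx => ⟨hx.1, hx.2.le.trans hcK⟩)]
  · refine setIntegral_congr_fun measurableSet_Ioo fun x hx => ?_
    simp only [negPow, if_pos (sub_neg.mpr hx.2)]
  · intro x hx
    have : ¬ x - c < 0 := fun h => hx.2 ⟨hx.1.1, sub_neg.mp h⟩
    simp [negPow, this]

/-- The product lives on `y < b < c`, whereas the convolution formula for `scaledPow` integrates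
from `c` to `y`; the reversed orientation gives the sign. -/
theorem integral_negPow_mul_negPow (lam : ℝ) {n k : ℕ} (hn : 0 < n) (hk : 0 < k) {a c K y : ℝ}
    (hac : a ≤ c) (hcK : c ≤ K) (hay : a ≤ y) :
    ∫ b in a..K, negPow lam k (y - b) * negPow lam n (b - c) = -negPow lam (n + k) (y - c) := by
  rw [integral_mul_negPow lam n hac hcK, intervalIntegral.integral_of_le hac]
  by_cases hyc : y < c
  · rw [setIntegral_eq_of_subset_of_forall_sdiff_eq_zero measurableSet_Ioc (s := Set.Ioc y c)
      (fun x hx => ⟨hay.trans_lt hx.1, hx.2⟩)]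
    · rw [negPow, if_pos (sub_neg.mpr hyc), ← scaledPow_conv lam hn hk, intervalIntegral.integral_symm,
        neg_neg, intervalIntegral.integral_of_le hyc.le]
      refine setIntegral_congr_fun measurableSet_Ioc fun x hx => ?_
      simp only [negPow, if_pos (sub_neg.mpr hx.1)]
      ring
    · intro x hx
      have : ¬ y - x < 0 := fun h => hx.2 ⟨sub_neg.mp h, hx.1.2⟩
      simp [negPow, this]
  · rw [negPow, if_neg (by linarith), neg_zero]
    refine setIntegral_eq_zero_of_forall_eq_zero fun x hx => ?_
    have : ¬ y - x < 0 := by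
      have := hx.2
      linarith
    simp [negPow, this]

end OnOff

/-! ### Basis laws, their integrals, and the coefficient matrix -/

namespace OnOff

open scoped Nat

noncomputable section

/-- On `[0, M)`, the solution of the renewal equation whose inhomogeneity comes from
`scaledPow lam n (x - c)` on `[M, 2 M)`. -/
def low (m : ℕ) (lam M c : ℝ) (n : ℕ) (x : ℝ) : ℝ :=
  Real.exp (-lam * M) * (lam ^ (n + m) * ∑ t ∈ Finset.range n,
    (M - c) ^ (n - 1 - t) / ((n - 1 - t)! : ℝ) * cyc m lam (m + t) x)

/-- Truncated power with break point `c`, continued to `[0, M)` by `low`. -/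
def mode (m : ℕ) (lam M c : ℝ) (n : ℕ) (x : ℝ) : ℝ :=
  if x < M then low m lam M c n x else negPow lam n (x - c)

/-- The coefficient of `α r / r!` in the density, without the factor `exp (-lam x)`. -/
def profile (m l : ℕ) (lam M K : ℝ) (r : ℕ) (x : ℝ) : ℝ :=
  ∑ q ∈ Finset.range (l - 1), Real.exp (-lam * M * q) *
      mode m lam M (K - q * M) ((q + 1) * m - r) x
    - ∑ q ∈ Finset.Icc 1 (l - 2), Real.exp (-lam * M * q) * mode m lam M (K - q * M) (q * m) x

/-- Integration of `v` against one mode. -/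
def modeInt (m : ℕ) (lam M K c : ℝ) (n : ℕ) (v : ℝ → ℝ) : ℝ :=
  ∫ b in Set.Ico 0 K, v b * (Real.exp (-lam * b) * mode m lam M c n b)

/-- Integration of `v` against the coefficient of `α r / r!` in the stationary law. -/
def basisInt (m l : ℕ) (lam M K : ℝ) (r : ℕ) (v : ℝ → ℝ) : ℝ :=
  (∫ b in Set.Ico 0 K, v b * (Real.exp (-lam * b) * profile m l lam M K r b)) +
    Real.exp (-lam * K) * v K

/-- Measurable functions that are bounded on `[0, K]`. -/
def Adm (K : ℝ) (v : ℝ → ℝ) : Prop := Measurable v ∧ ∃ D, ∀ b ∈ Set.Icc 0 K, |v b| ≤ D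

/-- Density of the Erlang distribution. -/
def erl (m : ℕ) (lam y : ℝ) : ℝ := if 0 ≤ y then Real.exp (-lam * y) * scaledPow lam m y else 0

/-- The exponential moments that determine the density beyond `K - M`. -/
def expMoment (lam M K : ℝ) (s : ℕ) (b : ℝ) : ℝ :=
  lam ^ s * (Real.exp (lam * (b - txPower M b)) * (K - (b - txPower M b)) ^ s)

end

theorem Adm.mul {K : ℝ} {v w : ℝ → ℝ} (hv : Adm K v) (hw : Adm K w) :
    Adm K (fun b => v b * w b) := by
  obtain ⟨hv, D, hD⟩ := hv
  obtain ⟨hw, E, hE⟩ := hw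
  refine ⟨hv.mul hw, D * E, fun b hb => ?_⟩
  rw [abs_mul]
  exact mul_le_mul (hD b hb) (hE b hb) (abs_nonneg _) ((abs_nonneg _).trans (hD b hb))

theorem Adm.add {K : ℝ} {v w : ℝ → ℝ} (hv : Adm K v) (hw : Adm K w) :
    Adm K (fun b => v b + w b) := by
  obtain ⟨hv, D, hD⟩ := hv
  obtain ⟨hw, E, hE⟩ := hw
  exact ⟨hv.add hw, D + E, fun b hb => (abs_add_le _ _).trans (add_le_add (hD b hb) (hE b hb))⟩

theorem Adm.sub {K : ℝ} {v w : ℝ → ℝ} (hv : Adm K v) (hw : Adm K w) :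
    Adm K (fun b => v b - w b) := by
  obtain ⟨hv, D, hD⟩ := hv
  obtain ⟨hw, E, hE⟩ := hw
  exact ⟨hv.sub hw, D + E, fun b hb => (abs_sub _ _).trans (add_le_add (hD b hb) (hE b hb))⟩

theorem Adm.const {K : ℝ} (a : ℝ) : Adm K (fun _ => a) := ⟨measurable_const, |a|, fun _ _ => le_rfl⟩

theorem Adm.sum {K : ℝ} {ι : Type*} (s : Finset ι) {v : ι → ℝ → ℝ} (h : ∀ i ∈ s, Adm K (v i)) :
    Adm K (fun b => ∑ i ∈ s, v i b) := by
  classical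
  induction s using Finset.induction_on with
  | empty => simpa using Adm.const (K := K) 0
  | insert i s hi ih =>
    simp_rw [Finset.sum_insert hi]
    exact (h i (Finset.mem_insert_self _ _)).add
      (ih fun j hj => h j (Finset.mem_insert_of_mem hj))

theorem Adm.of_continuous {K : ℝ} {v : ℝ → ℝ} (h : Continuous v) : Adm K v := by
  obtain ⟨D, hD⟩ := isCompact_Icc.exists_bound_of_continuousOn (s := Set.Icc 0 K) h.continuousOn
  exact ⟨h.measurable, D, hD⟩

theorem Adm.ite {K : ℝ} {p : ℝ → Prop} [DecidablePred p] (hp : MeasurableSet {b | p b})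
    {v w : ℝ → ℝ} (hv : Adm K v) (hw : Adm K w) : Adm K (fun b => if p b then v b else w b) := by
  obtain ⟨hv, D, hD⟩ := hv
  obtain ⟨hw, E, hE⟩ := hw
  refine ⟨Measurable.ite hp hv hw, max D E, fun b hb => ?_⟩
  dsimp only
  split_ifs
  · exact (hD b hb).trans (le_max_left _ _)
  · exact (hE b hb).trans (le_max_right _ _)

theorem Adm.comp_txPower {K M : ℝ} {v : ℝ → ℝ} (h : Continuous v) :
    Adm K (fun b => v (b - txPower M b)) := by
  have h1 : Adm K (fun b => if M < b then v (b - M) else v (b - 0)) :=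
    Adm.ite (measurableSet_Ioi (a := M)) (.of_continuous (by fun_prop)) (.of_continuous (by fun_prop))
  convert h1 using 2 with b
  rw [txPower]
  split_ifs <;> rfl

theorem measurable_txPower (M : ℝ) : Measurable (txPower M) :=
  Measurable.ite (measurableSet_Ioi (a := M)) measurable_const measurable_const

theorem Adm.integrableOn {K : ℝ} {v : ℝ → ℝ} (hv : Adm K v) : IntegrableOn v (Set.Ico 0 K) := by
  obtain ⟨hv, D, hD⟩ := hv
  refine Measure.integrableOn_of_bounded (M := D) (by simp) hv.aestronglyMeasurable ?_
  filter_upwards [ae_restrict_mem measurableSet_Ico] with b hb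
  exact hD b ⟨hb.1, hb.2.le⟩

theorem continuous_low (m : ℕ) (lam M c : ℝ) (n : ℕ) : Continuous (low m lam M c n) := by
  have := fun n => continuous_cyc (m := m) (lam := lam) n
  unfold low
  fun_prop

theorem adm_mode (m : ℕ) (lam M K c : ℝ) (n : ℕ) : Adm K (mode m lam M c n) := by
  have h := continuous_scaledPow lam n
  have h1 : Adm K (fun x => if x - c < 0 then scaledPow lam n (x - c) else 0) :=
    Adm.ite (measurableSet_lt (by fun_prop) (by fun_prop)) (.of_continuous (by fun_prop)) (.const 0)
  exact Adm.ite (measurableSet_Iio (a := M)) (.of_continuous (continuous_low m lam M c n)) h1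

theorem adm_exp (lam K : ℝ) : Adm K (fun b => Real.exp (-lam * b)) := .of_continuous (by fun_prop)

theorem adm_profile (m l : ℕ) (lam M K : ℝ) (r : ℕ) : Adm K (profile m l lam M K r) :=
  (Adm.sum _ fun _ _ => (Adm.const _).mul (adm_mode ..)).sub
    (Adm.sum _ fun _ _ => (Adm.const _).mul (adm_mode ..))

theorem adm_expMoment (lam M K : ℝ) (s : ℕ) : Adm K (expMoment lam M K s) :=
  Adm.comp_txPower (v := fun z => lam ^ s * (Real.exp (lam * z) * (K - z) ^ s)) (by fun_prop)

theorem basisInt_eq (m l : ℕ) (lam M K : ℝ) (r : ℕ) {v : ℝ → ℝ} (hv : Adm K v) :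
    basisInt m l lam M K r v =
      ∑ q ∈ Finset.range (l - 1), Real.exp (-lam * M * q) *
        modeInt m lam M K (K - q * M) ((q + 1) * m - r) v
      - ∑ q ∈ Finset.Icc 1 (l - 2), Real.exp (-lam * M * q) *
        modeInt m lam M K (K - q * M) (q * m) v + Real.exp (-lam * K) * v K := by
  rw [basisInt]
  have h : ∀ b, v b * (Real.exp (-lam * b) * profile m l lam M K r b) =
      ∑ q ∈ Finset.range (l - 1), Real.exp (-lam * M * q) *
        (v b * (Real.exp (-lam * b) * mode m lam M (K - q * M) ((q + 1) * m - r) b))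
      - ∑ q ∈ Finset.Icc 1 (l - 2), Real.exp (-lam * M * q) *
        (v b * (Real.exp (-lam * b) * mode m lam M (K - q * M) (q * m) b)) := by
    intro b
    rw [profile, mul_sub, mul_sub, Finset.mul_sum, Finset.mul_sum, Finset.mul_sum, Finset.mul_sum]
    congr 1 <;> exact Finset.sum_congr rfl fun q _ => by ring
  have hi : ∀ (a c : ℝ) (n : ℕ), Adm K fun b => a *
        (v b * (Real.exp (-lam * b) * mode m lam M c n b)) := fun a c n =>
    (Adm.const _).mul (hv.mul ((adm_exp lam K).mul (adm_mode ..)))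
  simp_rw [h]
  congr 1
  rw [integral_sub (Adm.sum _ fun q _ => hi _ _ _).integrableOn
    (Adm.sum _ fun q _ => hi _ _ _).integrableOn,
    integral_finsetSum _ fun q _ => (hi _ _ _).integrableOn,
    integral_finsetSum _ fun q _ => (hi _ _ _).integrableOn]
  simp_rw [integral_const_mul]
  rfl

/-- Integration of a function of the energy after transmission against one mode. -/
theorem modeInt_comp (m : ℕ) {lam M K : ℝ} (hM : 0 ≤ M) (hMK : M ≤ K) (c : ℝ) (n : ℕ) (u : ℝ → ℝ)
    (hu : Adm K fun b => u (b - txPower M b)) :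
    modeInt m lam M K c n (fun b => u (b - txPower M b)) =
      (∫ b in (0 : ℝ)..M, u b * (Real.exp (-lam * b) * low m lam M c n b)) +
      ∫ b in M..K, u (b - M) * Real.exp (-lam * b) * negPow lam n (b - c) := by
  have hi : IntegrableOn (fun b => u (b - txPower M b) *
      (Real.exp (-lam * b) * mode m lam M c n b)) (Set.Ico 0 K) :=
    (hu.mul ((adm_exp lam K).mul (adm_mode ..))).integrableOn
  -- Both the policy and `mode` change branch at `M` but treat the point `M` itself differently;
  -- passing to open intervals discards it.
  rw [modeInt, ← Set.Ico_union_Ico_eq_Ico hM hMK, setIntegral_union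
    (Set.Ico_disjoint_Ico_same) measurableSet_Ico
    (hi.mono_set (Set.Ico_subset_Ico_right hMK)) (hi.mono_set (Set.Ico_subset_Ico_left hM)),
    intervalIntegral.integral_of_le hM, intervalIntegral.integral_of_le hMK,
    integral_Ico_eq_integral_Ioo, integral_Ioc_eq_integral_Ioo, integral_Ico_eq_integral_Ioo,
    integral_Ioc_eq_integral_Ioo]
  congr 1
  · refine setIntegral_congr_fun measurableSet_Ioo fun b hb => ?_
    simp only [txPower, mode, if_pos hb.2, if_neg hb.2.le.not_gt, sub_zero]
  · refine setIntegral_congr_fun measurableSet_Ioo fun b hb => ?_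
    simp only [txPower, mode, if_pos hb.1, if_neg hb.1.le.not_gt]
    ring

theorem modeInt_one (m : ℕ) {lam M K c : ℝ} (hlam : lam ≠ 0) (hM : 0 ≤ M) (hMc : M ≤ c) (hcK : c ≤ K)
    {n : ℕ} (hn : 0 < n) :
    modeInt m lam M K c n (fun _ => 1) =
      Real.exp (-lam * M) * (lam ^ (n + m) * ∑ t ∈ Finset.range n,
        (M - c) ^ (n - 1 - t) / ((n - 1 - t)! : ℝ) * H m lam M t) +
      (-Real.exp (-lam * c) + Real.exp (-lam * M) * ∑ t ∈ Finset.range n,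
        (lam * (M - c)) ^ t / (t ! : ℝ)) := by
  have h := modeInt_comp m (lam := lam) hM (hMc.trans hcK) c n (fun _ => 1) (Adm.const 1)
  rw [h]
  congr 1
  · have : ∀ b, 1 * (Real.exp (-lam * b) * low m lam M c n b) = ∑ t ∈ Finset.range n,
        Real.exp (-lam * M) * (lam ^ (n + m) *
        ((M - c) ^ (n - 1 - t) / ((n - 1 - t)! : ℝ))) * (Real.exp (-lam * b) * cyc m lam (m + t) b) := by
      intro b
      rw [low, Finset.mul_sum, Finset.mul_sum, Finset.mul_sum, one_mul]
      exact Finset.sum_congr rfl fun _ _ => by ring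
    simp_rw [this]
    have := fun n => continuous_cyc (m := m) (lam := lam) n
    rw [intervalIntegral.integral_finsetSum fun b _ =>
      (by fun_prop : Continuous _).intervalIntegrable _ _, Finset.mul_sum, Finset.mul_sum]
    refine Finset.sum_congr rfl fun t _ => ?_
    rw [intervalIntegral.integral_const_mul, integral_exp_mul_cyc m hlam]
    ring
  · simp_rw [one_mul]
    rw [integral_mul_negPow lam n hMc hcK fun b => Real.exp (-lam * b),
      integral_exp_mul_scaledPow lam M c hn]

/-- The exponential in the moment cancels the factor `exp (-lam * b)` of the density, up to the
constant `exp (-lam * M)` where transmission occurs. What remains is the integral defining `F` below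
`M` and a polynomial integral above. -/
theorem modeInt_expMoment (m : ℕ) {lam M K c : ℝ} (hlam : lam ≠ 0) (hM : 0 ≤ M) (hMc : M ≤ c)
    (hcK : c ≤ K) {n : ℕ} (hn : 0 < n) (s : ℕ) :
    modeInt m lam M K c n (expMoment lam M K s) =
      lam ^ s * (Real.exp (-lam * M) * (lam ^ (n + m) * ∑ t ∈ Finset.range n,
        (M - c) ^ (n - 1 - t) / ((n - 1 - t)! : ℝ) * F m lam M K t s)) -
      lam ^ s * (Real.exp (-lam * M) * (lam ^ n * ∑ t ∈ Finset.range (s + 1),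
        (s.choose t : ℝ) * K ^ (s - t) * (t ! : ℝ) * ((M - c) ^ (n + t) / ((n + t)! : ℝ)))) := by
  have h := modeInt_comp m (lam := lam) hM (hMc.trans hcK) c n
    (fun z => lam ^ s * (Real.exp (lam * z) * (K - z) ^ s)) (adm_expMoment lam M K s)
  have he : ∀ x, Real.exp (lam * x) * Real.exp (-lam * x) = 1 := fun x => by
    rw [← Real.exp_add]
    simp
  change modeInt m lam M K c n (expMoment lam M K s) = _ at h
  rw [h, sub_eq_add_neg]
  congr 1
  · have : ∀ b, lam ^ s * (Real.exp (lam * b) * (K - b) ^ s) *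
        (Real.exp (-lam * b) * low m lam M c n b) = ∑ t ∈ Finset.range n,
        lam ^ s * (Real.exp (-lam * M) * (lam ^ (n + m) *
        ((M - c) ^ (n - 1 - t) / ((n - 1 - t)! : ℝ)))) * ((K - b) ^ s * cyc m lam (m + t) b) := by
      intro b
      have : lam ^ s * (Real.exp (lam * b) * (K - b) ^ s) *
          (Real.exp (-lam * b) * low m lam M c n b) = lam ^ s * (K - b) ^ s * low m lam M c n b := by
        linear_combination lam ^ s * (K - b) ^ s * low m lam M c n b * he b
      rw [this, low, Finset.mul_sum, Finset.mul_sum, Finset.mul_sum]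
      exact Finset.sum_congr rfl fun _ _ => by ring
    simp_rw [this]
    have := fun n => continuous_cyc (m := m) (lam := lam) n
    rw [intervalIntegral.integral_finsetSum fun b _ =>
      (by fun_prop : Continuous _).intervalIntegrable _ _, Finset.mul_sum, Finset.mul_sum,
      Finset.mul_sum]
    refine Finset.sum_congr rfl fun t _ => ?_
    rw [intervalIntegral.integral_const_mul, integral_pow_mul_cyc hlam]
    ring
  · have : ∀ b, lam ^ s * (Real.exp (lam * (b - M)) * (K - (b - M)) ^ s) * Real.exp (-lam * b) =
        lam ^ s * Real.exp (-lam * M) * (K + M - b) ^ s := by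
      intro b
      rw [show lam * (b - M) = lam * b + -lam * M by ring, Real.exp_add,
        show K - (b - M) = K + M - b by ring]
      linear_combination lam ^ s * Real.exp (-lam * M) * (K + M - b) ^ s * he b
    simp_rw [this, mul_assoc (lam ^ s * _)]
    rw [intervalIntegral.integral_const_mul,
      integral_mul_negPow lam n hMc hcK fun b => (K + M - b) ^ s,
      integral_pow_mul_scaledPow lam M c K hn]
    ring

theorem sum_range_eq_add_sum_Icc {l : ℕ} (hl : 3 ≤ l) (g : ℕ → ℝ) :
    ∑ q ∈ Finset.range (l - 1), g q = g 0 + ∑ q ∈ Finset.Icc 1 (l - 2), g q := by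
  obtain ⟨k, rfl⟩ := Nat.exists_eq_add_of_le hl
  rw [show 3 + k - 1 = k + 2 by omega, show 3 + k - 2 = k + 1 by omega, Finset.sum_range_succ',
    Finset.range_eq_Ico, Finset.sum_Ico_add' (fun x => g x) 0 (k + 1) 1, add_comm]
  rfl

/-- The meaning of the matrix: column `r` compares the mass of the `r`-th basis law with its
exponential moments. -/
theorem coeffMatrix_eq {m l : ℕ} (hl : 3 ≤ l) {lam M K : ℝ} (hlam : lam ≠ 0) (hM : 0 < M)
    (hK : K = l * M) (s r : Fin m) :
    coeffMatrix m l lam M K s r = 1 / ((r : ℕ)! : ℝ) *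
      (basisInt m l lam M K r (fun _ => 1) - basisInt m l lam M K r (expMoment lam M K s)) := by
  have hl' : (3 : ℝ) ≤ l := by exact_mod_cast hl
  have hMK : M < K := by nlinarith
  have hr := r.isLt
  have hm : 0 < m := by omega
  rw [basisInt_eq _ _ _ _ _ _ (Adm.const 1), basisInt_eq _ _ _ _ _ _ (adm_expMoment lam M K s)]
  rw [coeffMatrix, Matrix.of_apply]
  congr 1
  have hc : ∀ q ∈ Finset.range (l - 1), M ≤ K - q * M ∧ K - q * M ≤ K := by
    intro q hq
    have h1 : q + 1 ≤ l - 1 := Finset.mem_range.mp hq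
    have h2 : ((q + 2 : ℕ) : ℝ) ≤ l := by exact_mod_cast (by omega : q + 2 ≤ l)
    push_cast at h2
    constructor <;> nlinarith [mul_nonneg (Nat.cast_nonneg (α := ℝ) q) hM.le]
  have hexp : ∀ q : ℕ, Real.exp (-lam * M * (q + 1)) =
      Real.exp (-lam * M * q) * Real.exp (-lam * M) := by
    intro q
    rw [← Real.exp_add]
    ring_nf
  have hexpK : ∀ q : ℕ, Real.exp (-lam * M * q) * Real.exp (-lam * (K - q * M)) =
      Real.exp (-lam * K) := by
    intro q
    rw [← Real.exp_add]
    ring_nf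
  set S : ℕ → ℕ → ℝ := fun q n => ∑ t ∈ Finset.range n, (lam * ((q + 1) * M - K)) ^ t / (t ! : ℝ)
    with hS
  set W : ℕ → ℕ → ℝ := fun q n => lam ^ n * ∑ t ∈ Finset.range (s + 1 : ℕ),
    ((s : ℕ).choose t : ℝ) * K ^ (s - t : ℕ) * (t ! : ℝ) *
      (((q + 1) * M - K) ^ (n + t) / ((n + t)! : ℝ)) with hW
  set Y : ℕ → ℕ → ℝ := fun q n => ∑ t ∈ Finset.range n,
    ((q + 1) * M - K) ^ (n - 1 - t) / ((n - 1 - t)! : ℝ) *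
      (H m lam M t - lam ^ (s : ℕ) * F m lam M K t s) with hY
  -- Contribution of one mode, in the shape common to both families of degrees `(q + 1) * m - r` and
  -- `q * m`.
  have hD : ∀ q ∈ Finset.range (l - 1), ∀ n, 0 < n →
      Real.exp (-lam * M * q) * modeInt m lam M K (K - q * M) n (fun _ => 1) -
        Real.exp (-lam * M * q) * modeInt m lam M K (K - q * M) n (expMoment lam M K s) =
      lam ^ (n + m) * Real.exp (-lam * M * (q + 1)) * Y q n - Real.exp (-lam * K) +
        Real.exp (-lam * M * (q + 1)) * S q n +
        lam ^ (s : ℕ) * Real.exp (-lam * M * (q + 1)) * W q n := by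
    intro q hq n hn
    rw [modeInt_one m hlam hM.le (hc q hq).1 (hc q hq).2 hn,
      modeInt_expMoment m hlam hM.le (hc q hq).1 (hc q hq).2 hn, hexp, ← hexpK q,
      show M - (K - q * M) = (q + 1) * M - K by ring]
    simp only [hS, hW, hY, mul_sub, Finset.sum_sub_distrib]
    have : ∑ t ∈ Finset.range n, ((q + 1) * M - K) ^ (n - 1 - t) / ((n - 1 - t)! : ℝ) *
        (lam ^ (s : ℕ) * F m lam M K t s) = lam ^ (s : ℕ) * ∑ t ∈ Finset.range n,
        ((q + 1) * M - K) ^ (n - 1 - t) / ((n - 1 - t)! : ℝ) * F m lam M K t s := by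
      rw [Finset.mul_sum]
      exact Finset.sum_congr rfl fun _ _ => by ring
    rw [this]
    ring
  have hpos1 : ∀ q : ℕ, 0 < (q + 1) * m - r := fun q => by
    have : m ≤ (q + 1) * m := Nat.le_mul_of_pos_left m (by omega)
    omega
  have hsum : ∀ a b c d x y : ℝ, (a - b + x) - (c - d + y) = (a - c) - (b - d) + (x - y) := by
    intros; ring
  rw [hsum, ← Finset.sum_sub_distrib, ← Finset.sum_sub_distrib,
    Finset.sum_congr rfl fun q hq => hD q hq _ (hpos1 q),
    Finset.sum_congr (s₁ := Finset.Icc 1 (l - 2)) rfl fun q hq => hD q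
      (by rw [Finset.mem_Icc] at hq; exact Finset.mem_range.mpr (by omega)) (q * m)
      (Nat.mul_pos (by rw [Finset.mem_Icc] at hq; omega) hm)]
  have hX3 : ∀ q ∈ Finset.range (l - 1), Real.exp (-lam * M * (q + 1)) *
      ∑ t ∈ Finset.Ico (q * m) ((q + 1) * m - r), lam ^ t * ((q + 1) * M - K) ^ t / (t ! : ℝ) =
      Real.exp (-lam * M * (q + 1)) * S q ((q + 1) * m - r) -
        Real.exp (-lam * M * (q + 1)) * S q (q * m) := by
    intro q _
    have : q * m ≤ (q + 1) * m - r := by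
      rw [add_mul]
      omega
    simp_rw [← mul_pow]
    rw [Finset.sum_Ico_eq_sub _ this, mul_sub]
  have hX4 : ∀ q ∈ Finset.range (l - 1), lam ^ (s : ℕ) * K ^ (s : ℕ) * (lam ^ (q * m) *
      Real.exp (-lam * M * (q + 1)) * ∑ t ∈ Finset.range ((s : ℕ) + 1),
              ((s : ℕ).choose t : ℝ) * (K ^ t)⁻¹ * (t ! : ℝ) *
                (lam ^ (m - r : ℕ) * ((q + 1) * M - K) ^ ((q + 1) * m - r + t) /
                    (((q + 1) * m - r + t)! : ℝ)
                  - ((q + 1) * M - K) ^ (q * m + t) / ((q * m + t)! : ℝ))) =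
      lam ^ (s : ℕ) * Real.exp (-lam * M * (q + 1)) * W q ((q + 1) * m - r) -
        lam ^ (s : ℕ) * Real.exp (-lam * M * (q + 1)) * W q (q * m) := by
    intro q _
    have h1 : (q + 1) * m - r = q * m + (m - r) := by
      rw [add_mul]
      omega
    simp only [hW, Finset.mul_sum, ← Finset.sum_sub_distrib]
    refine Finset.sum_congr rfl fun t ht => ?_
    have h2 : K ^ (s : ℕ) = K ^ (s - t : ℕ) * K ^ t := by
      rw [← pow_add, Nat.sub_add_cancel (Nat.lt_succ_iff.mp (Finset.mem_range.mp ht))]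
    have h3 : K ^ t ≠ 0 := pow_ne_zero _ (hM.trans hMK).ne'
    have h4 : lam ^ ((q + 1) * m - r : ℕ) = lam ^ (q * m) * lam ^ (m - r : ℕ) := by
      rw [h1, pow_add]
    rw [h2, h4]
    field_simp
  rw [Finset.mul_sum, Finset.sum_congr rfl hX3, Finset.sum_congr rfl hX4]
  simp only [Finset.sum_add_distrib, Finset.sum_sub_distrib, Finset.sum_const, Finset.card_range,
    Nat.card_Icc]
  have hY1 : ∀ q : ℕ, (q + 2) * m - r = (q + 1) * m - r + m := by
    intro q
    have := hpos1 q
    have : (q + 2) * m = (q + 1) * m + m := by ring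
    omega
  have hY2 : ∀ q : ℕ, (q + 1) * m = q * m + m := fun q => by ring
  -- The matrix subtracts degree `q * m` terms from `q = 0` on, the profile only from `q = 1`. The
  -- extra `W 0 0` is accounted for by the moment of the atom at `K`, and the extra `S 0 0` is an
  -- empty sum.
  have hW0 : Real.exp (-lam * M) * W 0 0 = Real.exp (-lam * K) * (Real.exp (lam * (K - M)) * M ^ (s : ℕ)) := by
    rw [← mul_assoc (Real.exp (-lam * K)), ← Real.exp_add, show -lam * K + lam * (K - M) = -lam * M by ring]
    congr 1
    simp only [hW, Nat.cast_zero, zero_add, pow_zero, one_mul]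
    rw [show M ^ (s : ℕ) = ((M - K) + K) ^ (s : ℕ) by ring, add_pow]
    refine Finset.sum_congr rfl fun t _ => ?_
    have : (t ! : ℝ) ≠ 0 := by positivity
    field_simp
  have hS0 : S 0 0 = 0 := by simp [hS]
  have hpsi : expMoment lam M K s K = lam ^ (s : ℕ) * (Real.exp (lam * (K - M)) * M ^ (s : ℕ)) := by
    rw [expMoment, txPower, if_pos hMK]
    congr 3
    ring
  rw [sum_range_eq_add_sum_Icc hl fun q => Real.exp (-lam * M * (q + 1)) * S q (q * m),
    sum_range_eq_add_sum_Icc hl fun q => lam ^ (s : ℕ) * Real.exp (-lam * M * (q + 1)) * W q (q * m),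
    hpsi]
  simp_rw [hY1]
  -- The constants `-exp (-lam * K)` occur `l - 1` times in one sum and `l - 2` times in the other;
  -- the one left over cancels the mass of the atom.
  have hcard : ((l - 1 : ℕ) : ℝ) - ((l - 2 + 1 - 1 : ℕ) : ℝ) = 1 := by
    rw [show l - 2 + 1 - 1 = l - 2 by omega, Nat.cast_sub (by omega), Nat.cast_sub (by omega)]
    push_cast
    ring
  simp only [nsmul_eq_mul, Nat.cast_zero, zero_mul, zero_add, mul_one, hS0, mul_zero]
  simp only [hY]
  simp_rw [hY2]
  linear_combination -lam ^ (s : ℕ) * hW0 + Real.exp (-lam * K) * hcard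

end OnOff

/-! ### The Erlang kernel integrated against the basis laws -/

namespace OnOff

open scoped Nat

/-- The renewal equation on `[0, M)` without exponentials: levels below `M` contribute the first
integral, levels from which `M` is spent the second. Term by term in the expansion of `scaledPow`
about `M - c`, it is `cyc_add_period`. -/
theorem low_conv {m : ℕ} (hm : 0 < m) {lam : ℝ} (hlam : lam ≠ 0) (M c x : ℝ) {n : ℕ} (hn : 0 < n) :
    (∫ b in (0 : ℝ)..x, scaledPow lam m (x - b) * low m lam M c n b) +
      Real.exp (-lam * M) * ∫ b in M..(x + M), scaledPow lam m (x + M - b) * scaledPow lam n (b - c) =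
    low m lam M c n x := by
  obtain ⟨k, rfl⟩ := Nat.exists_eq_add_of_lt hm
  simp only [zero_add] at *
  have hcc := fun n => continuous_cyc (m := k + 1) (lam := lam) n
  have hsp := fun n => continuous_scaledPow lam n
  have h1 : ∀ b, scaledPow lam (k + 1) (x - b) * low (k + 1) lam M c n b = ∑ t ∈ Finset.range n,
      Real.exp (-lam * M) * (lam ^ (n + (k + 1)) * ((M - c) ^ (n - 1 - t) / ((n - 1 - t)! : ℝ))) *
        (lam ^ (k + 1) * (cyc (k + 1) lam (k + 1 + t) b * ((x - b) ^ k / (k ! : ℝ)))) := by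
    intro b
    rw [low, Finset.mul_sum, Finset.mul_sum, Finset.mul_sum]
    refine Finset.sum_congr rfl fun t _ => ?_
    rw [scaledPow, Nat.add_sub_cancel]
    ring
  have h2 : ∀ b, scaledPow lam (k + 1) (x + M - (b + M)) * scaledPow lam n (b + M - c) =
      ∑ t ∈ Finset.range n, lam ^ (n + (k + 1)) * ((M - c) ^ (n - 1 - t) / ((n - 1 - t)! : ℝ)) *
        ((b - 0) ^ t / (t ! : ℝ) * ((x - b) ^ k / (k ! : ℝ))) := by
    intro b
    rw [add_sub_assoc b M c, scaledPow_add lam hn, Finset.mul_sum, Finset.mul_sum]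
    refine Finset.sum_congr rfl fun t _ => ?_
    rw [scaledPow, Nat.add_sub_cancel, add_sub_add_right_eq_sub, pow_add, sub_zero]
    ring
  have h3 := intervalIntegral.integral_comp_add_right (a := 0) (b := x)
    (fun b => scaledPow lam (k + 1) (x + M - b) * scaledPow lam n (b - c)) M
  rw [zero_add] at h3
  rw [← h3]
  simp_rw [h1, h2]
  rw [intervalIntegral.integral_finsetSum fun b _ =>
      (by fun_prop : Continuous _).intervalIntegrable _ _,
    intervalIntegral.integral_finsetSum fun b _ =>
      (by fun_prop : Continuous _).intervalIntegrable _ _, low, Finset.mul_sum, Finset.mul_sum,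
      Finset.mul_sum, ← Finset.sum_add_distrib]
  refine Finset.sum_congr rfl fun t _ => ?_
  rw [intervalIntegral.integral_const_mul, intervalIntegral.integral_const_mul,
    intervalIntegral.integral_const_mul, integral_cyc_mul_pow hlam, integral_pow_mul_pow,
    show k + 1 + t + k + 1 = k + 1 + t + (k + 1) by ring, cyc_add_period (Nat.succ_ne_zero k) hlam,
    show t + k + 1 = k + 1 + t by ring, sub_zero]
  ring

theorem erl_eq (m : ℕ) (lam y : ℝ) :
    erl m lam y = Real.exp (-lam * y) * (scaledPow lam m y - negPow lam m y) := by
  rw [erl, negPow]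
  by_cases h : 0 ≤ y
  · rw [if_pos h, if_neg h.not_gt, sub_zero]
  · rw [if_neg h, if_pos (lt_of_not_ge h), sub_self, mul_zero]

theorem adm_erl (m : ℕ) (lam M K x : ℝ) : Adm K fun b => erl m lam (x - (b - txPower M b)) := by
  have hm := measurable_txPower M
  have hsp := continuous_scaledPow lam m
  exact Adm.ite (measurableSet_le measurable_const (by fun_prop)) (Adm.comp_txPower
    (v := fun z => Real.exp (-lam * (x - z)) * scaledPow lam m (x - z)) (by fun_prop)) (.const 0)

theorem adm_negPow (m : ℕ) (lam M K x : ℝ) :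
    Adm K fun b => Real.exp (lam * (b - txPower M b)) * negPow lam m (x - (b - txPower M b)) := by
  have hm := measurable_txPower M
  have hsp := continuous_scaledPow lam m
  exact (Adm.comp_txPower (v := fun z => Real.exp (lam * z)) (by fun_prop)).mul
    (Adm.ite (measurableSet_lt (by fun_prop) measurable_const) (Adm.comp_txPower
      (v := fun z => scaledPow lam m (x - z)) (by fun_prop)) (.const 0))

/-- A target `x < M` is reachable only from levels up to `x` or from levels between `M` and `x + M`.
As `x + M < 2 * M ≤ c`, the second range lies left of the break point, so the mode is a single
polynomial there. -/
theorem modeInt_erl {m : ℕ} (hm : 0 < m) {lam M K c x : ℝ} (hlam : lam ≠ 0) (hx : 0 ≤ x)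
    (hxM : x < M) (hMc : 2 * M ≤ c) (hcK : c ≤ K) {n : ℕ} (hn : 0 < n) :
    modeInt m lam M K c n (fun b => erl m lam (x - (b - txPower M b))) =
      Real.exp (-lam * x) * low m lam M c n x := by
  have hM : 0 < M := hx.trans_lt hxM
  rw [modeInt_comp m hM.le (by linarith) c n (fun z => erl m lam (x - z)) (adm_erl ..),
    ← low_conv hm hlam M c x hn, mul_add, intervalIntegral.integral_of_le hM.le,
    intervalIntegral.integral_of_le (by linarith : M ≤ K), intervalIntegral.integral_of_le hx,
    intervalIntegral.integral_of_le (by linarith : M ≤ x + M), ← integral_const_mul,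
    ← integral_const_mul, ← integral_const_mul,
    setIntegral_eq_of_subset_of_forall_sdiff_eq_zero measurableSet_Ioc (s := Set.Ioc 0 x) (t := Set.Ioc 0 M)
      (fun b hb => ⟨hb.1, hb.2.trans hxM.le⟩),
    setIntegral_eq_of_subset_of_forall_sdiff_eq_zero measurableSet_Ioc (s := Set.Ioc M (x + M))
      (t := Set.Ioc M K) (fun b hb => ⟨hb.1, hb.2.trans (by linarith)⟩)]
  · congr 1
    · refine setIntegral_congr_fun measurableSet_Ioc fun b hb => ?_
      rw [erl, if_pos (sub_nonneg.mpr hb.2), show -lam * x = -lam * (x - b) + -lam * b by ring,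
        Real.exp_add]
      ring
    · refine setIntegral_congr_fun measurableSet_Ioc fun b hb => ?_
      have h1 : b - c < 0 := by linarith [hb.2]
      rw [erl, if_pos (by linarith [hb.2]), negPow, if_pos h1, sub_sub_eq_add_sub, ← mul_assoc,
        ← Real.exp_add, show -lam * x + -lam * M = -lam * (x + M - b) + -lam * b by ring, Real.exp_add]
      ring
  · intro b hb
    rw [erl, if_neg, zero_mul, zero_mul]
    intro h
    exact hb.2 ⟨hb.1.1, by linarith⟩
  · intro b hb
    rw [erl, if_neg, zero_mul]
    intro h
    exact hb.2 ⟨hb.1.1, by linarith⟩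

/-- The shift behind the telescoping: the break point moves down by `M` and the degree rises by `m`.
Levels below `M` do not contribute, since there the kernel has argument `x - b ≥ 0`. -/
theorem modeInt_negPow {m : ℕ} (hm : 0 < m) {lam M K c x : ℝ} (hM : 0 ≤ M)
    (hxM : M ≤ x) (hMc : M ≤ c) (hcK : c ≤ K) {n : ℕ} (hn : 0 < n) :
    modeInt m lam M K c n
        (fun b => Real.exp (lam * (b - txPower M b)) * negPow lam m (x - (b - txPower M b))) =
      -(Real.exp (-lam * M) * negPow lam (n + m) (x + M - c)) := by
  rw [modeInt_comp m hM (hMc.trans hcK) c n (fun z => Real.exp (lam * z) * negPow lam m (x - z))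
    (adm_negPow ..), intervalIntegral.integral_of_le hM, setIntegral_eq_zero_of_forall_eq_zero, zero_add]
  · have : ∀ b, Real.exp (lam * (b - M)) * negPow lam m (x - (b - M)) * Real.exp (-lam * b) *
        negPow lam n (b - c) = Real.exp (-lam * M) * (negPow lam m (x + M - b) * negPow lam n (b - c)) := by
      intro b
      rw [show -lam * M = lam * (b - M) + -lam * b by ring, Real.exp_add, sub_sub_eq_add_sub]
      ring
    simp_rw [this]
    rw [intervalIntegral.integral_const_mul, integral_negPow_mul_negPow lam hn hm hMc hcK (by linarith)]
    ring
  · intro b hb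
    rw [negPow, if_neg (by linarith [hb.2])]
    ring

theorem basisInt_zero {m l : ℕ} {lam M K : ℝ} (hK : 0 ≤ K) (r : ℕ) {v : ℝ → ℝ}
    (hv : ∀ b ∈ Set.Icc 0 K, v b = 0) : basisInt m l lam M K r v = 0 := by
  rw [basisInt, hv K ⟨hK, le_rfl⟩, setIntegral_eq_zero_of_forall_eq_zero]
  · ring
  · intro b hb
    rw [hv b ⟨hb.1, hb.2.le⟩, zero_mul]

theorem integrableOn_mul_profile (m l : ℕ) (lam M : ℝ) {K : ℝ} (r : ℕ) {v : ℝ → ℝ} (hv : Adm K v) :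
    IntegrableOn (fun b => v b * (Real.exp (-lam * b) * profile m l lam M K r b)) (Set.Ico 0 K) :=
  (hv.mul ((adm_exp lam K).mul (adm_profile ..))).integrableOn

theorem basisInt_const_mul (m l : ℕ) (lam M K : ℝ) (r : ℕ) (a : ℝ) (v : ℝ → ℝ) :
    basisInt m l lam M K r (fun b => a * v b) = a * basisInt m l lam M K r v := by
  simp only [basisInt, mul_assoc a]
  rw [integral_const_mul]
  ring

theorem basisInt_sub (m l : ℕ) (lam M : ℝ) {K : ℝ} (r : ℕ) {v w : ℝ → ℝ} (hv : Adm K v)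
    (hw : Adm K w) : basisInt m l lam M K r (fun b => v b - w b) =
      basisInt m l lam M K r v - basisInt m l lam M K r w := by
  simp only [basisInt, sub_mul]
  rw [integral_sub (integrableOn_mul_profile m l lam M r hv) (integrableOn_mul_profile m l lam M r hw)]
  ring

theorem basisInt_sum (m l : ℕ) (lam M : ℝ) {K : ℝ} (r : ℕ) {ι : Type*} (s : Finset ι)
    {v : ι → ℝ → ℝ} (hv : ∀ i ∈ s, Adm K (v i)) : basisInt m l lam M K r (fun b => ∑ i ∈ s, v i b) =
      ∑ i ∈ s, basisInt m l lam M K r (v i) := by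
  simp only [basisInt, Finset.sum_mul]
  rw [integral_finsetSum _ fun i hi => integrableOn_mul_profile m l lam M r (hv i hi),
    Finset.sum_add_distrib, Finset.mul_sum]

/-- Separation of variables: writing `x - z = (K - z) + (x - K)` in the polynomial part isolates the
dependence on `b` in `m` moments, and the truncated power removes the part with `x < z`. -/
theorem erl_expand {m : ℕ} (hm : 0 < m) (lam M K x b : ℝ) :
    erl m lam (x - (b - txPower M b)) = Real.exp (-lam * x) *
      ((∑ t ∈ Finset.range m, scaledPow lam (m - t) (x - K) / (t ! : ℝ) * expMoment lam M K t b) -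
        Real.exp (lam * (b - txPower M b)) * negPow lam m (x - (b - txPower M b))) := by
  rw [erl_eq]
  set z := b - txPower M b with hz
  rw [show -lam * (x - z) = -lam * x + lam * z by ring, Real.exp_add, mul_assoc]
  congr 1
  rw [mul_sub]
  congr 1
  rw [show x - z = (K - z) + (x - K) by ring, scaledPow_add lam hm, Finset.mul_sum, Finset.mul_sum]
  refine Finset.sum_congr rfl fun t ht => ?_
  rw [expMoment, ← hz, scaledPow, show m - 1 - t = m - t - 1 by omega,
    show lam ^ m = lam ^ (m - t) * lam ^ t by
      rw [← pow_add, Nat.sub_add_cancel (Finset.mem_range.mp ht).le]]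
  ring

theorem basisInt_erl {m : ℕ} (hm : 0 < m) (l : ℕ) (lam M : ℝ) {K : ℝ} (r : ℕ) (x : ℝ) :
    basisInt m l lam M K r (fun b => erl m lam (x - (b - txPower M b))) = Real.exp (-lam * x) *
      ((∑ t ∈ Finset.range m, scaledPow lam (m - t) (x - K) / (t ! : ℝ) *
        basisInt m l lam M K r (expMoment lam M K t)) -
        basisInt m l lam M K r (fun b =>
          Real.exp (lam * (b - txPower M b)) * negPow lam m (x - (b - txPower M b)))) := by
  have h : ∀ t ∈ Finset.range m, Adm K fun b =>
      scaledPow lam (m - t) (x - K) / (t ! : ℝ) * expMoment lam M K t b :=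
    fun t _ => (Adm.const _).mul (adm_expMoment ..)
  simp_rw [erl_expand hm lam M K x]
  rw [basisInt_const_mul, basisInt_sub _ _ _ _ _ (Adm.sum _ h) (adm_negPow ..), basisInt_sum _ _ _ _ _ _ h]
  simp_rw [basisInt_const_mul]

theorem break_bounds {l : ℕ} (hl : 3 ≤ l) {M K : ℝ} (hM : 0 < M) (hK : K = l * M) {q : ℕ}
    (hq : q ∈ Finset.range (l - 1)) : 2 * M ≤ K - q * M ∧ K - q * M ≤ K := by
  have h1 : q + 2 ≤ l := by
    have := Finset.mem_range.mp hq
    omega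
  have h2 : ((q + 2 : ℕ) : ℝ) ≤ l := by exact_mod_cast h1
  push_cast at h2
  constructor <;> nlinarith [mul_nonneg (Nat.cast_nonneg (α := ℝ) q) hM.le]

theorem mem_range_of_mem_Icc {l : ℕ} {q : ℕ} (hq : q ∈ Finset.Icc 1 (l - 2)) :
    q ∈ Finset.range (l - 1) := by
  rw [Finset.mem_Icc] at hq
  exact Finset.mem_range.mpr (by omega)

theorem pos_degree {m r : ℕ} (hr : r < m) (q : ℕ) : 0 < (q + 1) * m - r := by
  have : m ≤ (q + 1) * m := Nat.le_mul_of_pos_left m (by omega)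
  omega

/-- Each mode reproduces itself below `M`, and the atom contributes nothing since `K - M > M > x`.
No condition on the moments is involved. -/
theorem basisInt_erl_of_lt {m l : ℕ} (hl : 3 ≤ l) {lam M K x : ℝ} (hlam : lam ≠ 0)
    (hK : K = l * M) {r : ℕ} (hr : r < m) (hx : 0 ≤ x) (hxM : x < M) :
    basisInt m l lam M K r (fun b => erl m lam (x - (b - txPower M b))) =
      Real.exp (-lam * x) * profile m l lam M K r x := by
  have hM : 0 < M := hx.trans_lt hxM
  have hm : 0 < m := by omega
  have hl' : (3 : ℝ) ≤ l := by exact_mod_cast hl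
  have hMK : 2 * M < K := by nlinarith
  rw [basisInt_eq _ _ _ _ _ _ (adm_erl ..), erl, if_neg, mul_zero, add_zero, profile, mul_sub,
    Finset.mul_sum, Finset.mul_sum]
  · congr 1
    · refine Finset.sum_congr rfl fun q hq => ?_
      have h := break_bounds hl hM hK hq
      rw [modeInt_erl hm hlam hx hxM h.1 h.2 (pos_degree hr q), mode, if_pos hxM]
      ring
    · refine Finset.sum_congr rfl fun q hq => ?_
      have h := break_bounds hl hM hK (mem_range_of_mem_Icc hq)
      rw [modeInt_erl hm hlam hx hxM h.1 h.2 (Nat.mul_pos (Finset.mem_Icc.mp hq).1 hm), mode, if_pos hxM]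
      ring
  · rw [txPower, if_pos (by linarith)]
    linarith

theorem txPower_le_self {M b : ℝ} (hb : 0 ≤ b) : txPower M b ≤ b := by
  rw [txPower]
  split_ifs with h
  · exact h.le
  · exact hb

theorem txPower_nonneg {M : ℝ} (hM : 0 ≤ M) (b : ℝ) : 0 ≤ txPower M b := by
  rw [txPower]
  split_ifs
  · exact hM
  · exact le_rfl

theorem basisInt_erl_of_neg {m l : ℕ} {lam M K x : ℝ} (hK : 0 ≤ K) (r : ℕ) (hx : x < 0) :
    basisInt m l lam M K r (fun b => erl m lam (x - (b - txPower M b))) = 0 := by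
  refine basisInt_zero hK r fun b hb => ?_
  rw [erl, if_neg]
  linarith [txPower_le_self (M := M) hb.1]

theorem basisInt_negPow_of_ge {m l : ℕ} {lam M K x : ℝ} (hM : 0 ≤ M) (hK : 0 ≤ K) (r : ℕ) (hx : K ≤ x) :
    basisInt m l lam M K r
      (fun b => Real.exp (lam * (b - txPower M b)) * negPow lam m (x - (b - txPower M b))) = 0 := by
  refine basisInt_zero hK r fun b hb => ?_
  rw [negPow, if_neg, mul_zero]
  linarith [txPower_nonneg hM b, hb.2]

/-- The truncated kernel sends the `q`-th term of each sum to minus the `(q + 1)`-st. The missing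
initial terms are the free polynomial `scaledPow lam (m - r) (x - K)` and the contribution of the
atom. -/
theorem profile_eq {m l : ℕ} (hl : 3 ≤ l) {lam M K x : ℝ} (hM : 0 < M)
    (hK : K = l * M) {r : ℕ} (hr : r < m) (hMx : M ≤ x) (hxK : x < K) :
    profile m l lam M K r x = scaledPow lam (m - r) (x - K) - basisInt m l lam M K r
      (fun b => Real.exp (lam * (b - txPower M b)) * negPow lam m (x - (b - txPower M b))) := by
  have hm : 0 < m := by omega
  rw [basisInt_eq _ _ _ _ _ _ (adm_negPow ..),
    Finset.sum_congr rfl fun q hq => by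
      have h := break_bounds hl hM hK hq
      rw [modeInt_negPow hm hM.le hMx (by linarith) h.2 (pos_degree hr q)],
    Finset.sum_congr (s₁ := Finset.Icc 1 (l - 2)) rfl fun q hq => by
      have h := break_bounds hl hM hK (mem_range_of_mem_Icc hq)
      rw [modeInt_negPow hm hM.le hMx (by linarith) h.2 (Nat.mul_pos (Finset.mem_Icc.mp hq).1 hm)]]
  have hMK : M < K := hMx.trans_lt hxK
  have hexp : ∀ q : ℕ, Real.exp (-lam * M * q) * Real.exp (-lam * M) =
      Real.exp (-lam * M * (q + 1 : ℕ)) := by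
    intro q
    rw [← Real.exp_add]
    push_cast
    ring_nf
  set A : ℕ → ℝ := fun q => Real.exp (-lam * M * q) * negPow lam ((q + 1) * m - r) (x - (K - q * M))
    with hA
  set B : ℕ → ℝ := fun q => Real.exp (-lam * M * q) * negPow lam (q * m) (x - (K - q * M)) with hB
  have hp : profile m l lam M K r x = ∑ q ∈ Finset.range (l - 1), A q - ∑ q ∈ Finset.Icc 1 (l - 2), B q := by
    simp only [profile, mode, if_neg hMx.not_gt, hA, hB]
  have hA1 : ∀ q : ℕ, Real.exp (-lam * M * q) * -(Real.exp (-lam * M) *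
      negPow lam ((q + 1) * m - r + m) (x + M - (K - q * M))) = -A (q + 1) := by
    intro q
    rw [mul_neg, ← mul_assoc, hexp, hA]
    dsimp only
    rw [show (q + 1 + 1) * m - r = (q + 1) * m - r + m by
        have := pos_degree hr q
        rw [add_mul (q + 1)]
        omega]
    congr 3
    push_cast
    ring
  have hB1 : ∀ q : ℕ, Real.exp (-lam * M * q) * -(Real.exp (-lam * M) *
      negPow lam (q * m + m) (x + M - (K - q * M))) = -B (q + 1) := by
    intro q
    rw [mul_neg, ← mul_assoc, hexp, hB]
    dsimp only
    rw [add_mul q, one_mul]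
    congr 3
    push_cast
    ring
  -- This is where `K = l * M` closes the telescope: the term shifted past the end has break point
  -- `M` and vanishes for `x ≥ M`.
  have hlast : x - (K - (l - 1 : ℕ) * M) = x - M := by
    rw [hK, Nat.cast_sub (by omega)]
    push_cast
    ring
  have hAl : A (l - 1) = 0 := by
    simp only [hA]
    rw [hlast, negPow, if_neg (by linarith), mul_zero]
  have hBl : B (l - 1) = 0 := by
    simp only [hB]
    rw [hlast, negPow, if_neg (by linarith), mul_zero]
  have hA0 : A 0 = scaledPow lam (m - r) (x - K) := by
    simp only [hA]
    rw [negPow, if_pos (by simpa using hxK)]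
    simp
  -- From a full buffer the energy left is `K - M`, the first shifted break point, so the atom
  -- supplies exactly the term `q = 1` of the second sum.
  have hatom : Real.exp (-lam * K) * (Real.exp (lam * (K - txPower M K)) *
      negPow lam m (x - (K - txPower M K))) = B 1 := by
    simp only [hB]
    rw [txPower, if_pos hMK, ← mul_assoc, ← Real.exp_add]
    push_cast
    ring_nf
  rw [hp, hatom, Finset.sum_congr rfl fun q _ => hA1 q,
    Finset.sum_congr (s₁ := Finset.Icc 1 (l - 2)) rfl fun q _ => hB1 q, Finset.sum_neg_distrib,
    Finset.sum_neg_distrib, ← hA0]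
  have e1 := Finset.sum_range_succ A (l - 1)
  have e2 := Finset.sum_range_succ' A (l - 1)
  have e3 := sum_range_eq_add_sum_Icc hl B
  have e4 := sum_range_eq_add_sum_Icc hl fun q => B (q + 1)
  have e5 := Finset.sum_range_succ B (l - 1)
  have e6 := Finset.sum_range_succ' B (l - 1)
  simp only [zero_add] at e4
  linarith

end OnOff

/-! ### The transition operator and the defect of a signed law -/

namespace OnOff

open scoped Nat

theorem gammaPDFReal_natCast {m : ℕ} (hm : 0 < m) (lam : ℝ) :
    gammaPDFReal (m : ℝ) lam = erl m lam := by
  obtain ⟨k, rfl⟩ := Nat.exists_eq_add_of_lt hm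
  funext y
  simp only [zero_add, gammaPDFReal, erl, scaledPow, Nat.add_sub_cancel, Nat.cast_add, Nat.cast_one,
    Real.Gamma_nat_eq_factorial, add_sub_cancel_right, Real.rpow_natCast]
  rw [← Nat.cast_add_one, Real.rpow_natCast, neg_mul]
  congr 1
  ring

theorem erl_nonneg {m : ℕ} (hm : 0 < m) {lam : ℝ} (hlam : 0 < lam) (y : ℝ) : 0 ≤ erl m lam y := by
  rw [← gammaPDFReal_natCast hm]
  exact gammaPDFReal_nonneg (by exact_mod_cast hm) hlam y

theorem measurable_erl (m : ℕ) (lam : ℝ) : Measurable (erl m lam) := by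
  have := continuous_scaledPow lam m
  exact Measurable.ite measurableSet_Ici (by fun_prop) measurable_const

theorem integral_gammaMeasure {m : ℕ} (hm : 0 < m) {lam : ℝ} (hlam : 0 < lam) (v : ℝ → ℝ) :
    ∫ y, v y ∂gammaMeasure (m : ℝ) lam = ∫ y, erl m lam y * v y := by
  have h : gammaPDF (m : ℝ) lam = fun y => ENNReal.ofReal (erl m lam y) := by
    funext y
    rw [gammaPDF, gammaPDFReal_natCast hm]
  rw [gammaMeasure, h, integral_withDensity_eq_integral_toReal_smul
    (measurable_erl m lam).ennreal_ofReal (by simp)]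
  simp_rw [ENNReal.toReal_ofReal (erl_nonneg hm hlam _), smul_eq_mul]

theorem integral_erl {m : ℕ} (hm : 0 < m) {lam : ℝ} (hlam : 0 < lam) : ∫ y, erl m lam y = 1 := by
  have := isProbabilityMeasure_gammaMeasure (a := (m : ℝ)) (by exact_mod_cast hm) hlam
  have h := integral_gammaMeasure hm hlam fun _ => 1
  simpa using h.symm

theorem integrable_erl {m : ℕ} (hm : 0 < m) {lam : ℝ} (hlam : 0 < lam) : Integrable (erl m lam) := by
  by_contra h
  have := integral_erl hm hlam
  rw [integral_undef h] at this
  exact zero_ne_one this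

noncomputable section

/-- The transition operator of the storage process. -/
def stepOp (m : ℕ) (lam M K : ℝ) (v : ℝ → ℝ) (b : ℝ) : ℝ :=
  ∫ y, v (step M K b y) ∂gammaMeasure (m : ℝ) lam

/-- The density attached to the coefficient vector `α`. -/
def dens (m l : ℕ) (lam M K : ℝ) (α : Fin m → ℝ) (x : ℝ) : ℝ :=
  Real.exp (-lam * x) * ∑ r : Fin m, α r / ((r : ℕ)! : ℝ) * profile m l lam M K r x

/-- Integration against the signed law attached to the coefficient vector `α`. -/
def lawInt (m l : ℕ) (lam M K : ℝ) (α : Fin m → ℝ) (v : ℝ → ℝ) : ℝ :=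
  (∫ b in Set.Ico 0 K, v b * dens m l lam M K α b) + fullProb m lam K α * v K

end

theorem stepOp_eq {m : ℕ} (hm : 0 < m) {lam : ℝ} (hlam : 0 < lam) (M K : ℝ) (v : ℝ → ℝ) (b : ℝ) :
    stepOp m lam M K v b = ∫ x, v (min x K) * erl m lam (x - (b - txPower M b)) := by
  rw [stepOp, integral_gammaMeasure hm hlam, ← integral_sub_right_eq_self _ (b - txPower M b)]
  refine integral_congr_ae (Eventually.of_forall fun x => ?_)
  dsimp only
  rw [step, add_sub_cancel, mul_comm]

theorem adm_dens (m l : ℕ) (lam M K : ℝ) (α : Fin m → ℝ) : Adm K (dens m l lam M K α) :=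
  (adm_exp lam K).mul (Adm.sum _ fun _ _ => (Adm.const _).mul (adm_profile ..))

theorem integrable_erl_prod {m : ℕ} (hm : 0 < m) {lam : ℝ} (hlam : 0 < lam) (M : ℝ) {K : ℝ}
    {d : ℝ → ℝ} (hd : Adm K d) :
    Integrable (fun z : ℝ × ℝ => erl m lam (z.2 - (z.1 - txPower M z.1)) * d z.1)
      ((volume.restrict (Set.Ico 0 K)).prod volume) := by
  have h1 := measurable_txPower M
  have h2 := measurable_erl m lam
  have h3 := hd.1
  rw [integrable_prod_iff (by fun_prop : Measurable _).aestronglyMeasurable]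
  refine ⟨Eventually.of_forall fun b => ((integrable_erl hm hlam).comp_sub_right
    (b - txPower M b)).mul_const (d b), ?_⟩
  have : (fun b : ℝ => ∫ x, ‖erl m lam (x - (b - txPower M b)) * d b‖) = fun b => ‖d b‖ := by
    funext b
    simp_rw [norm_mul]
    rw [integral_mul_const]
    simp_rw [Real.norm_of_nonneg (erl_nonneg hm hlam _)]
    rw [integral_sub_right_eq_self (erl m lam), integral_erl hm hlam, one_mul]
  rw [this]
  exact hd.integrableOn.norm

/-- Fubini's theorem for one step of the process. -/
theorem integral_stepOp {m : ℕ} (hm : 0 < m) {lam : ℝ} (hlam : 0 < lam) (M : ℝ) {K : ℝ}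
    {d : ℝ → ℝ} (hd : Adm K d) (p : ℝ) {v : ℝ → ℝ} (hv : Measurable v) {D : ℝ} (hD : ∀ x, |v x| ≤ D) :
    Integrable (fun x => v (min x K) * ((∫ b in Set.Ico 0 K, erl m lam (x - (b - txPower M b)) * d b) +
      p * erl m lam (x - (K - txPower M K)))) ∧
    (∫ b in Set.Ico 0 K, stepOp m lam M K v b * d b) + p * stepOp m lam M K v K =
      ∫ x, v (min x K) * ((∫ b in Set.Ico 0 K, erl m lam (x - (b - txPower M b)) * d b) +
        p * erl m lam (x - (K - txPower M K))) := by
  have hvm : Measurable fun x => v (min x K) := hv.comp (by fun_prop)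
  have h0 := integrable_erl_prod hm hlam M hd
  have h1 : Integrable (Function.uncurry fun b x => v (min x K) *
      (erl m lam (x - (b - txPower M b)) * d b)) ((volume.restrict (Set.Ico 0 K)).prod volume) :=
    h0.bdd_mul (c := D) (hvm.comp measurable_snd).aestronglyMeasurable (Eventually.of_forall fun z => hD _)
  have h2 : Integrable fun x => v (min x K) * (p * erl m lam (x - (K - txPower M K))) :=
    (((integrable_erl hm hlam).comp_sub_right _).const_mul p).bdd_mul (c := D)
      hvm.aestronglyMeasurable (Eventually.of_forall fun z => hD _)
  have h3 : Integrable fun x => v (min x K) * ∫ b in Set.Ico 0 K,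
      erl m lam (x - (b - txPower M b)) * d b := by
    have := h1.integral_prod_right
    simpa only [Function.uncurry, integral_const_mul] using this
  constructor
  · simp_rw [mul_add]
    exact h3.add h2
  · simp_rw [mul_add]
    rw [integral_add h3 h2]
    congr 1
    · have := integral_integral_swap h1
      simp_rw [integral_const_mul] at this
      rw [← this]
      refine integral_congr_ae (Eventually.of_forall fun b => ?_)
      dsimp only
      rw [stepOp_eq hm hlam, ← integral_mul_const]
      simp_rw [mul_assoc]
    · rw [stepOp_eq hm hlam, ← integral_const_mul]
      exact integral_congr_ae (Eventually.of_forall fun b => by ring)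

theorem lawInt_eq (m l : ℕ) (lam M : ℝ) {K : ℝ} (α : Fin m → ℝ) {v : ℝ → ℝ} (hv : Adm K v) :
    lawInt m l lam M K α v = ∑ r : Fin m, α r / ((r : ℕ)! : ℝ) * basisInt m l lam M K r v := by
  have h : ∀ b, v b * dens m l lam M K α b = ∑ r : Fin m, α r / ((r : ℕ)! : ℝ) *
      (v b * (Real.exp (-lam * b) * profile m l lam M K r b)) := by
    intro b
    rw [dens, Finset.mul_sum, Finset.mul_sum]
    exact Finset.sum_congr rfl fun r _ => by ring
  rw [lawInt]
  simp_rw [h]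
  rw [integral_finsetSum (f := fun (r : Fin m) b => α r / ((r : ℕ)! : ℝ) *
      (v b * (Real.exp (-lam * b) * profile m l lam M K r b))) _
    fun r _ => (integrableOn_mul_profile m l lam M r hv).const_mul _, fullProb]
  simp_rw [integral_const_mul, basisInt, mul_add, Finset.sum_add_distrib]
  congr 1
  rw [Finset.mul_sum, Finset.sum_mul]
  exact Finset.sum_congr rfl fun r _ => by ring

noncomputable section

/-- The amount by which `α` fails to reproduce itself as a vector of exponential moments. -/
def defect (m l : ℕ) (lam M K : ℝ) (α : Fin m → ℝ) (r : Fin m) : ℝ :=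
  α r - lawInt m l lam M K α (expMoment lam M K r)

/-- The exponential polynomial with coefficients `δ`. -/
def expPoly (m : ℕ) (lam K : ℝ) (δ : Fin m → ℝ) (x : ℝ) : ℝ :=
  ∑ r : Fin m, δ r / ((r : ℕ)! : ℝ) * (Real.exp (-lam * x) * scaledPow lam (m - r) (x - K))

end

theorem lawInt_erl {m : ℕ} (hm : 0 < m) (l : ℕ) (lam M : ℝ) {K : ℝ} (α : Fin m → ℝ) (x : ℝ) :
    lawInt m l lam M K α (fun b => erl m lam (x - (b - txPower M b))) =
      expPoly m lam K (fun r => lawInt m l lam M K α (expMoment lam M K r)) x -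
      Real.exp (-lam * x) * ∑ r : Fin m, α r / ((r : ℕ)! : ℝ) * basisInt m l lam M K r
        (fun b => Real.exp (lam * (b - txPower M b)) * negPow lam m (x - (b - txPower M b))) := by
  rw [lawInt_eq _ _ _ _ _ (adm_erl ..)]
  simp_rw [basisInt_erl hm, lawInt_eq _ _ _ _ _ (adm_expMoment ..), expPoly, mul_sub,
    Finset.sum_sub_distrib]
  congr 1
  · simp_rw [← Fin.sum_univ_eq_sum_range (fun t => scaledPow lam (m - t) (x - K) / (t ! : ℝ) *
      basisInt m l lam M K _ (expMoment lam M K t)) m, Finset.mul_sum]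
    rw [Finset.sum_comm]
    refine Finset.sum_congr rfl fun t _ => ?_
    rw [Finset.sum_div, Finset.sum_mul]
    exact Finset.sum_congr rfl fun r _ => by ring
  · rw [Finset.mul_sum]
    exact Finset.sum_congr rfl fun r _ => by ring

theorem lawInt_erl_of_neg {m l : ℕ} {lam M K x : ℝ} (hK : 0 ≤ K) (α : Fin m → ℝ) (hx : x < 0) :
    lawInt m l lam M K α (fun b => erl m lam (x - (b - txPower M b))) = 0 := by
  rw [lawInt_eq _ _ _ _ _ (adm_erl ..)]
  simp_rw [basisInt_erl_of_neg hK _ hx]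
  simp

theorem lawInt_erl_of_lt {m l : ℕ} (hl : 3 ≤ l) {lam M K x : ℝ} (hlam : lam ≠ 0)
    (hK : K = l * M) (α : Fin m → ℝ) (hx : 0 ≤ x) (hxM : x < M) :
    lawInt m l lam M K α (fun b => erl m lam (x - (b - txPower M b))) = dens m l lam M K α x := by
  rw [lawInt_eq _ _ _ _ _ (adm_erl ..), dens, Finset.mul_sum]
  refine Finset.sum_congr rfl fun r _ => ?_
  rw [basisInt_erl_of_lt hl hlam hK r.isLt hx hxM]
  ring

/-- In `profile_eq` the free polynomials carry the weights `α r / r!`; in the image of the law they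
carry the moments instead. The difference is the defect. -/
theorem lawInt_erl_of_mem {m l : ℕ} (hm : 0 < m) (hl : 3 ≤ l) {lam M K x : ℝ} (hM : 0 < M)
    (hK : K = l * M) (α : Fin m → ℝ) (hMx : M ≤ x) (hxK : x < K) :
    lawInt m l lam M K α (fun b => erl m lam (x - (b - txPower M b))) =
      dens m l lam M K α x - expPoly m lam K (defect m l lam M K α) x := by
  rw [lawInt_erl hm, dens]
  simp_rw [expPoly, defect, fun r : Fin m => profile_eq (m := m) (r := r) (lam := lam) hl hM hK r.isLt hMx hxK,
    mul_sub, Finset.sum_sub_distrib, sub_div, sub_mul, Finset.sum_sub_distrib, mul_sub, Finset.mul_sum]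
  have : ∀ r : Fin m, Real.exp (-lam * x) * (α r / ((r : ℕ)! : ℝ) * scaledPow lam (m - r) (x - K)) =
      α r / ((r : ℕ)! : ℝ) * (Real.exp (-lam * x) * scaledPow lam (m - r) (x - K)) := fun r => by ring
  simp_rw [this]
  ring

/-- Above `K` the cut-off is inactive, so the image density is determined by the moments alone; its
integral is what piles up at `K`. -/
theorem lawInt_erl_of_ge {m l : ℕ} (hm : 0 < m) {lam M K x : ℝ} (hM : 0 ≤ M)
    (hK : 0 ≤ K) (α : Fin m → ℝ) (hx : K ≤ x) :
    lawInt m l lam M K α (fun b => erl m lam (x - (b - txPower M b))) =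
      expPoly m lam K (fun r => lawInt m l lam M K α (expMoment lam M K r)) x := by
  rw [lawInt_erl hm]
  simp_rw [basisInt_negPow_of_ge hM hK _ hx]
  simp

/-- On `[K, ∞)` each summand is `exp (-lam * K)` times an Erlang density of shape `m - r` shifted to
`K`, which has total mass `1`. -/
theorem integral_expPoly_Ici {m : ℕ} {lam : ℝ} (hlam : 0 < lam) (K : ℝ) (δ : Fin m → ℝ) :
    ∫ x in Set.Ici K, expPoly m lam K δ x = Real.exp (-lam * K) * ∑ r : Fin m, δ r / ((r : ℕ)! : ℝ) := by
  have h : ∀ r : Fin m, ∀ x ∈ Set.Ici K, Real.exp (-lam * x) * scaledPow lam (m - r) (x - K) =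
      Real.exp (-lam * K) * erl (m - r) lam (x - K) := by
    intro r x hx
    rw [erl, if_pos (sub_nonneg.mpr hx), ← mul_assoc, ← Real.exp_add]
    ring_nf
  have hi : ∀ r : Fin m, IntegrableOn
      (fun x => Real.exp (-lam * x) * scaledPow lam (m - r) (x - K)) (Set.Ici K) := by
    intro r
    rw [integrableOn_congr_fun (h r) measurableSet_Ici]
    exact (((integrable_erl (Nat.sub_pos_of_lt r.isLt) hlam).comp_sub_right K).const_mul _).integrableOn
  simp only [expPoly]
  rw [integral_finsetSum _ fun r _ => (hi r).const_mul _, Finset.mul_sum]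
  refine Finset.sum_congr rfl fun r _ => ?_
  rw [integral_const_mul, setIntegral_congr_fun measurableSet_Ici (h r), integral_const_mul,
    setIntegral_eq_integral_of_forall_compl_eq_zero,
    integral_sub_right_eq_self (erl (m - r) lam), integral_erl (Nat.sub_pos_of_lt r.isLt) hlam]
  · ring
  · intro x hx
    rw [erl, if_neg]
    simpa using hx

/-- One step of the process changes the law attached to `α` only through the defect. -/
theorem lawInt_sub_lawInt_stepOp {m l : ℕ} (hm : 0 < m) (hl : 3 ≤ l) {lam M K : ℝ} (hlam : 0 < lam)
    (hM : 0 < M) (hK : K = l * M) (α : Fin m → ℝ) {v : ℝ → ℝ} (hv : Measurable v) {D : ℝ}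
    (hD : ∀ x, |v x| ≤ D) :
    lawInt m l lam M K α v - lawInt m l lam M K α (stepOp m lam M K v) =
      (∫ x in Set.Ico M K, v x * expPoly m lam K (defect m l lam M K α) x) +
      v K * (Real.exp (-lam * K) * ∑ r : Fin m, defect m l lam M K α r / ((r : ℕ)! : ℝ)) := by
  have hl' : (3 : ℝ) ≤ l := by exact_mod_cast hl
  have hMK : M < K := by nlinarith
  have hK0 : 0 < K := hM.trans hMK
  obtain ⟨hint, heq⟩ := integral_stepOp hm hlam M (adm_dens m l lam M K α) (fullProb m lam K α) hv hD
  -- The image density before truncation is by definition the law integrated against the Erlang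
  -- kernel.
  change Integrable (fun x => v (min x K) *
    lawInt m l lam M K α (fun b => erl m lam (x - (b - txPower M b)))) at hint
  change lawInt m l lam M K α (stepOp m lam M K v) = ∫ x, v (min x K) *
    lawInt m l lam M K α (fun b => erl m lam (x - (b - txPower M b))) at heq
  have hpoly : Continuous (expPoly m lam K (defect m l lam M K α)) := by
    have := fun r : Fin m => continuous_scaledPow lam (m - r)
    unfold expPoly
    fun_prop
  have hva : Adm K v := ⟨hv, D, fun b _ => hD b⟩
  have i1 : IntegrableOn (fun x => v x * dens m l lam M K α x) (Set.Ico 0 K) :=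
    (hva.mul (adm_dens ..)).integrableOn
  have i2 : IntegrableOn (fun x => v x * expPoly m lam K (defect m l lam M K α) x) (Set.Ico 0 K) :=
    (hva.mul (.of_continuous hpoly)).integrableOn
  have e1 : ∫ x in Set.Iio (0 : ℝ), v (min x K) *
      lawInt m l lam M K α (fun b => erl m lam (x - (b - txPower M b))) = 0 :=
    setIntegral_eq_zero_of_forall_eq_zero fun x hx => by
      rw [lawInt_erl_of_neg hK0.le α hx, mul_zero]
  have e2 : ∫ x in Set.Ico 0 M, v (min x K) *
      lawInt m l lam M K α (fun b => erl m lam (x - (b - txPower M b))) =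
      ∫ x in Set.Ico 0 M, v x * dens m l lam M K α x :=
    setIntegral_congr_fun measurableSet_Ico fun x hx => by
      rw [lawInt_erl_of_lt hl hlam.ne' hK α hx.1 hx.2, min_eq_left (hx.2.trans hMK).le]
  have e3 : ∫ x in Set.Ico M K, v (min x K) *
      lawInt m l lam M K α (fun b => erl m lam (x - (b - txPower M b))) =
      (∫ x in Set.Ico M K, v x * dens m l lam M K α x) -
        ∫ x in Set.Ico M K, v x * expPoly m lam K (defect m l lam M K α) x := by
    rw [← integral_sub (i1.mono_set (Set.Ico_subset_Ico_left hM.le))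
      (i2.mono_set (Set.Ico_subset_Ico_left hM.le))]
    refine setIntegral_congr_fun measurableSet_Ico fun x hx => ?_
    rw [lawInt_erl_of_mem hm hl hM hK α hx.1 hx.2, min_eq_left hx.2.le, mul_sub]
  have e4 : ∫ x in Set.Ici K, v (min x K) *
      lawInt m l lam M K α (fun b => erl m lam (x - (b - txPower M b))) =
      v K * (Real.exp (-lam * K) * ∑ r : Fin m,
        lawInt m l lam M K α (expMoment lam M K r) / ((r : ℕ)! : ℝ)) := by
    rw [← integral_expPoly_Ici hlam, ← integral_const_mul]
    refine setIntegral_congr_fun measurableSet_Ici fun x hx => ?_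
    rw [lawInt_erl_of_ge hm hM.le hK0.le α hx, min_eq_right hx]
  have s1 : ∫ x in Set.Ico 0 K, v x * dens m l lam M K α x =
      (∫ x in Set.Ico 0 M, v x * dens m l lam M K α x) + ∫ x in Set.Ico M K, v x * dens m l lam M K α x := by
    rw [← Set.Ico_union_Ico_eq_Ico hM.le hMK.le, setIntegral_union
      Set.Ico_disjoint_Ico_same measurableSet_Ico
      (i1.mono_set (Set.Ico_subset_Ico_right hMK.le)) (i1.mono_set (Set.Ico_subset_Ico_left hM.le))]
  have s2 : ∫ x, v (min x K) *
      lawInt m l lam M K α (fun b => erl m lam (x - (b - txPower M b))) =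
      (∫ x in Set.Iio 0, v (min x K) *
        lawInt m l lam M K α (fun b => erl m lam (x - (b - txPower M b)))) +
      ((∫ x in Set.Ico 0 M, v (min x K) *
        lawInt m l lam M K α (fun b => erl m lam (x - (b - txPower M b)))) +
      ∫ x in Set.Ico M K, v (min x K) *
        lawInt m l lam M K α (fun b => erl m lam (x - (b - txPower M b)))) +
      ∫ x in Set.Ici K, v (min x K) *
        lawInt m l lam M K α (fun b => erl m lam (x - (b - txPower M b))) := by
    rw [← setIntegral_union Set.Ico_disjoint_Ico_same measurableSet_Ico
      hint.integrableOn hint.integrableOn, Set.Ico_union_Ico_eq_Ico hM.le hMK.le,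
      ← setIntegral_union (Set.disjoint_left.mpr fun x hx hx' => hx.not_ge hx'.1) measurableSet_Ico
      hint.integrableOn hint.integrableOn, Set.Iio_union_Ico_eq_Iio hK0.le, ← Set.compl_Iio,
      integral_add_compl measurableSet_Iio hint]
  rw [heq, s2, e1, e2, e3, e4, lawInt, s1, fullProb]
  simp only [defect, sub_div, Finset.sum_sub_distrib]
  ring

theorem stepOp_const {m : ℕ} (hm : 0 < m) {lam : ℝ} (hlam : 0 < lam) (M K a : ℝ) :
    stepOp m lam M K (fun _ => a) = fun _ => a := by
  have := isProbabilityMeasure_gammaMeasure (a := (m : ℝ)) (by exact_mod_cast hm) hlam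
  funext b
  simp [stepOp]

/-- Conservation of mass forces a linear relation on the defect. -/
theorem sum_defect {m l : ℕ} (hm : 0 < m) (hl : 3 ≤ l) {lam M K : ℝ} (hlam : 0 < lam)
    (hM : 0 < M) (hK : K = l * M) (α : Fin m → ℝ) :
    ∑ r : Fin m, defect m l lam M K α r / ((r : ℕ)! : ℝ) *
      ∑ t ∈ Finset.range (m - r), (lam * (M - K)) ^ t / (t ! : ℝ) = 0 := by
  have hl' : (3 : ℝ) ≤ l := by exact_mod_cast hl
  have hMK : M < K := by nlinarith
  have h := lawInt_sub_lawInt_stepOp hm hl hlam hM hK α (v := fun _ => 1) measurable_const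
    (D := 1) (by simp)
  rw [stepOp_const hm hlam, sub_self] at h
  simp only [one_mul] at h
  rw [integral_Ico_eq_integral_Ioo, ← integral_Ioc_eq_integral_Ioo,
    ← intervalIntegral.integral_of_le hMK.le] at h
  have hc := fun r : Fin m => continuous_scaledPow lam (m - r)
  simp only [expPoly] at h
  rw [intervalIntegral.integral_finsetSum fun b _ =>
    (by fun_prop : Continuous _).intervalIntegrable _ _] at h
  simp_rw [intervalIntegral.integral_const_mul] at h
  rw [Finset.sum_congr rfl fun (r : Fin m) _ => by
    rw [integral_exp_mul_scaledPow lam M K (Nat.sub_pos_of_lt r.isLt)]] at h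
  have he : Real.exp (-lam * M) ≠ 0 := (Real.exp_pos _).ne'
  -- The end-point terms `-exp (-lam * K)` cancel the change of the atom, which leaves `exp (-lam *
  -- M)` times the claimed sum.
  refine (mul_eq_zero.mp ?_).resolve_left he
  rw [h, Finset.mul_sum, Finset.mul_sum, ← Finset.sum_add_distrib]
  exact Finset.sum_congr rfl fun r _ => by ring

end OnOff

/-! ### Doeblin contraction of the transition operator -/

namespace OnOff

open scoped Nat

theorem measurable_step (M K : ℝ) : Measurable fun z : ℝ × ℝ => step M K z.1 z.2 := by
  have := measurable_txPower M
  unfold step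
  fun_prop

theorem step_mem {M K b y : ℝ} (hK : 0 ≤ K) (hb : 0 ≤ b) (hy : 0 ≤ y) : step M K b y ∈ Set.Icc 0 K :=
  ⟨le_min (by linarith [txPower_le_self (M := M) hb]) hK, min_le_right _ _⟩

theorem step_eq_of_le {M K b y : ℝ} (hb : 0 ≤ b) (hy : K ≤ y) : step M K b y = K :=
  min_eq_right (by linarith [txPower_le_self (M := M) hb])

noncomputable section

/-- Probability that one harvest does not fill an empty buffer. -/
def missProb (m : ℕ) (lam K : ℝ) : ℝ := (gammaMeasure (m : ℝ) lam).real (Set.Iio K)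

/-- `v` is measurable and bounded by `D`. -/
def BddMeas (D : ℝ) (v : ℝ → ℝ) : Prop := Measurable v ∧ ∀ x, |v x| ≤ D

/-- The oscillation of `v` on `[0, K]` is at most `d`. -/
def OscLE (K d : ℝ) (v : ℝ → ℝ) : Prop :=
  ∀ x ∈ Set.Icc 0 K, ∀ y ∈ Set.Icc 0 K, |v x - v y| ≤ d

end

theorem BddMeas.adm {D K : ℝ} {v : ℝ → ℝ} (h : BddMeas D v) : Adm K v := ⟨h.1, D, fun b _ => h.2 b⟩

theorem BddMeas.oscLE {D : ℝ} {v : ℝ → ℝ} (h : BddMeas D v) (K : ℝ) : OscLE K (2 * D) v :=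
  fun x _ y _ => (abs_sub _ _).trans (by linarith [h.2 x, h.2 y])

theorem gammaMeasure_ae_nonneg (a r : ℝ) : ∀ᵐ y ∂gammaMeasure a r, 0 ≤ y := by
  rw [ae_iff]
  have : {y : ℝ | ¬ 0 ≤ y} = Set.Iio 0 := by
    ext y
    simp
  rw [this, gammaMeasure, withDensity_apply _ measurableSet_Iio]
  exact lintegral_gammaPDF_of_nonpos le_rfl

theorem stepOp_nonneg (m : ℕ) (lam M K : ℝ) {v : ℝ → ℝ} (h : ∀ x, 0 ≤ v x) (b : ℝ) : 0 ≤ stepOp m lam M K v b :=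
  integral_nonneg fun _ => h _

section
variable {m : ℕ} {lam : ℝ} (hm : 0 < m) (hlam : 0 < lam)
include hm hlam

theorem isProbabilityMeasure_gamma : IsProbabilityMeasure (gammaMeasure (m : ℝ) lam) :=
  isProbabilityMeasure_gammaMeasure (by exact_mod_cast hm) hlam

theorem missProb_nonneg_lt_one {K : ℝ} (hK : 0 ≤ K) : 0 ≤ missProb m lam K ∧ missProb m lam K < 1 := by
  have := isProbabilityMeasure_gamma hm hlam
  refine ⟨measureReal_nonneg, ?_⟩
  have h : 0 < (gammaMeasure (m : ℝ) lam) (Set.Ici K) := by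
    rw [gammaMeasure, withDensity_apply _ measurableSet_Ici, setLIntegral_pos_iff
      (show Measurable (gammaPDF (m : ℝ) lam) from (measurable_gammaPDFReal _ _).ennreal_ofReal)]
    refine lt_of_lt_of_le ?_ (measure_mono (s := Set.Ioi K) fun x hx => ⟨?_, Set.mem_Ici.mpr (le_of_lt hx)⟩)
    · simp
    · have : 0 < gammaPDFReal (m : ℝ) lam x :=
        gammaPDFReal_pos (by exact_mod_cast hm) hlam (hK.trans_lt hx)
      simpa [gammaPDF] using this
  have h2 := probReal_compl_eq_one_sub (μ := gammaMeasure (m : ℝ) lam) (measurableSet_Ici (a := K))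
  rw [Set.compl_Ici] at h2
  rw [missProb, h2]
  have : 0 < (gammaMeasure (m : ℝ) lam).real (Set.Ici K) :=
    ENNReal.toReal_pos h.ne' (measure_ne_top _ _)
  linarith

theorem BddMeas.stepOp {D M K : ℝ} {v : ℝ → ℝ} (h : BddMeas D v) :
    BddMeas D (stepOp m lam M K v) := by
  have := isProbabilityMeasure_gamma hm hlam
  constructor
  · have h1 : StronglyMeasurable (Function.uncurry fun b y => v (step M K b y)) :=
      (h.1.comp (measurable_step M K)).stronglyMeasurable
    exact h1.integral_prod_right.measurable
  · intro x
    have := norm_integral_le_of_norm_le_const (μ := gammaMeasure (m : ℝ) lam)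
      (f := fun y => v (step M K x y)) (C := D) (Eventually.of_forall fun y => h.2 _)
    exact this.trans_eq (by simp)

theorem BddMeas.stepOp_iterate {D M K : ℝ} {v : ℝ → ℝ} (h : BddMeas D v) (n : ℕ) :
    BddMeas D ((OnOff.stepOp m lam M K)^[n] v) := by
  induction n with
  | zero => exact h
  | succ n ih =>
    rw [Function.iterate_succ_apply']
    exact ih.stepOp hm hlam

theorem BddMeas.integrable_step {D : ℝ} (M K : ℝ) {v : ℝ → ℝ} (h : BddMeas D v) (b : ℝ) :
    Integrable (fun y => v (step M K b y)) (gammaMeasure (m : ℝ) lam) := by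
  have := isProbabilityMeasure_gamma hm hlam
  exact Integrable.of_bound (h.1.comp ((measurable_step M K).comp (by fun_prop :
    Measurable fun y : ℝ => (b, y)))).aestronglyMeasurable D (Eventually.of_forall fun y => h.2 _)

/-- Doeblin's contraction. -/
theorem OscLE.stepOp {D M K d : ℝ} (hK : 0 ≤ K) {v : ℝ → ℝ} (h : BddMeas D v) (ho : OscLE K d v) :
    OscLE K (missProb m lam K * d) (stepOp m lam M K v) := by
  have := isProbabilityMeasure_gamma hm hlam
  intro x hx y hy
  rw [OnOff.stepOp, OnOff.stepOp, ← integral_sub (h.integrable_step hm hlam M K x) (h.integrable_step hm hlam M K y)]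
  have h1 : ∫ t, (Set.Iio K).indicator (fun _ => d) t ∂gammaMeasure (m : ℝ) lam = missProb m lam K * d := by
    rw [integral_indicator_const _ measurableSet_Iio, missProb, smul_eq_mul]
  rw [← h1, ← Real.norm_eq_abs]
  refine norm_integral_le_of_norm_le ((integrable_const d).indicator measurableSet_Iio) ?_
  filter_upwards [gammaMeasure_ae_nonneg (m : ℝ) lam] with t ht
  -- Two copies driven by the same harvest `t` coalesce at `K` once `t ≥ K`; only harvests below `K`
  -- can preserve any oscillation.
  by_cases htK : t < K
  · rw [Set.indicator_of_mem (show t ∈ Set.Iio K from htK)]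
    exact ho _ (step_mem hK hx.1 ht) _ (step_mem hK hy.1 ht)
  · rw [Set.indicator_of_notMem (show t ∉ Set.Iio K from htK), step_eq_of_le hx.1 (not_lt.mp htK),
      step_eq_of_le hy.1 (not_lt.mp htK), sub_self, norm_zero]

theorem OscLE.stepOp_iterate {D M K d : ℝ} (hK : 0 ≤ K) {v : ℝ → ℝ} (h : BddMeas D v)
    (ho : OscLE K d v) (n : ℕ) :
    OscLE K (missProb m lam K ^ n * d) ((OnOff.stepOp m lam M K)^[n] v) := by
  induction n with
  | zero => simpa using ho
  | succ n ih =>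
    rw [Function.iterate_succ_apply', pow_succ', mul_assoc]
    exact OscLE.stepOp hm hlam hK (h.stepOp_iterate hm hlam n) ih

end

/-! ### Laws with zero defect: uniqueness and positivity -/

theorem lawInt_congr {m l : ℕ} {lam M K : ℝ} (hK : 0 ≤ K) (α : Fin m → ℝ) {v w : ℝ → ℝ}
    (h : ∀ b ∈ Set.Icc 0 K, v b = w b) : lawInt m l lam M K α v = lawInt m l lam M K α w := by
  rw [lawInt, lawInt, h K ⟨hK, le_rfl⟩]
  congr 1
  refine setIntegral_congr_fun measurableSet_Ico fun b hb => ?_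
  rw [h b ⟨hb.1, hb.2.le⟩]

theorem lawInt_sub_const (m l : ℕ) (lam M : ℝ) {K : ℝ} (α : Fin m → ℝ) {v : ℝ → ℝ} (hv : Adm K v)
    (a : ℝ) : lawInt m l lam M K α (fun b => v b - a) =
      lawInt m l lam M K α v - a * lawInt m l lam M K α (fun _ => 1) := by
  have h1 : IntegrableOn (fun b => v b * dens m l lam M K α b) (Set.Ico 0 K) :=
    (hv.mul (adm_dens ..)).integrableOn
  have h2 : IntegrableOn (fun b => a * dens m l lam M K α b) (Set.Ico 0 K) :=
    ((Adm.const a).mul (adm_dens ..)).integrableOn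
  simp only [lawInt, sub_mul, one_mul]
  rw [integral_sub h1 h2, integral_const_mul]
  ring

theorem abs_lawInt_le (m l : ℕ) (lam M : ℝ) {K : ℝ} (hK : 0 ≤ K) (α : Fin m → ℝ) {v : ℝ → ℝ} {e : ℝ}
    (he : ∀ b ∈ Set.Icc 0 K, |v b| ≤ e) : |lawInt m l lam M K α v| ≤
      e * ((∫ b in Set.Ico 0 K, |dens m l lam M K α b|) + |fullProb m lam K α|) := by
  rw [lawInt, mul_add]
  refine (abs_add_le _ _).trans (add_le_add ?_ ?_)
  · rw [← integral_const_mul, ← Real.norm_eq_abs]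
    refine norm_integral_le_of_norm_le ((adm_dens m l lam M K α).integrableOn.abs.const_mul e) ?_
    filter_upwards [ae_restrict_mem measurableSet_Ico] with b hb
    rw [norm_mul]
    exact mul_le_mul_of_nonneg_right (he b ⟨hb.1, hb.2.le⟩) (abs_nonneg _)
  · rw [abs_mul, mul_comm]
    exact mul_le_mul_of_nonneg_right (he K ⟨hK, le_rfl⟩) (abs_nonneg _)

theorem capacity_pos {l : ℕ} (hl : 3 ≤ l) {M K : ℝ} (hM : 0 < M) (hK : K = l * M) : 0 < K := by
  have hl' : (3 : ℝ) ≤ l := by exact_mod_cast hl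
  nlinarith

/-- The exponential moments need only be bounded on `[0, K]`, while the contraction argument uses
globally bounded functions. Cutting off outside `[0, K]` leaves all integrals against the law
unchanged. -/
theorem Adm.exists_bddMeas {K : ℝ} {v : ℝ → ℝ} (hv : Adm K v) :
    ∃ D, BddMeas D ((Set.Icc 0 K).indicator v) := by
  obtain ⟨hv, D, hD⟩ := hv
  refine ⟨|D|, hv.indicator measurableSet_Icc, fun x => ?_⟩
  by_cases hx : x ∈ Set.Icc 0 K
  · rw [Set.indicator_of_mem hx]
    exact (hD x hx).trans (le_abs_self D)
  · rw [Set.indicator_of_notMem hx]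
    simp

theorem lawInt_indicator (m l : ℕ) (lam M : ℝ) {K : ℝ} (hK : 0 ≤ K) (α : Fin m → ℝ) (v : ℝ → ℝ) :
    lawInt m l lam M K α ((Set.Icc 0 K).indicator v) = lawInt m l lam M K α v :=
  lawInt_congr hK _ fun _ hb => Set.indicator_of_mem hb v

section
variable {m l : ℕ} (hm : 0 < m) (hl : 3 ≤ l) {lam M K : ℝ} (hlam : 0 < lam) (hM : 0 < M)
  (hK : K = l * M)
include hm hl hlam hM hK

theorem lawInt_stepOp {α : Fin m → ℝ} (hα : defect m l lam M K α = 0) {v : ℝ → ℝ} {D : ℝ}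
    (hv : BddMeas D v) : lawInt m l lam M K α (stepOp m lam M K v) = lawInt m l lam M K α v := by
  have h := lawInt_sub_lawInt_stepOp hm hl hlam hM hK α hv.1 hv.2
  simp [hα, expPoly] at h
  linarith

theorem lawInt_stepOp_iterate {α : Fin m → ℝ} (hα : defect m l lam M K α = 0) {v : ℝ → ℝ} {D : ℝ}
    (hv : BddMeas D v) (n : ℕ) :
    lawInt m l lam M K α ((stepOp m lam M K)^[n] v) = lawInt m l lam M K α v := by
  induction n with
  | zero => rfl
  | succ n ih =>
    rw [Function.iterate_succ_apply', lawInt_stepOp hm hl hlam hM hK hα (hv.stepOp_iterate hm hlam n), ih]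

/-- Geometric convergence of the iterates of the transition operator to the stationary law. -/
theorem abs_lawInt_sub_le {α : Fin m → ℝ} (hα : defect m l lam M K α = 0) {v : ℝ → ℝ} {D : ℝ}
    (hv : BddMeas D v) (n : ℕ) :
    |lawInt m l lam M K α v -
      (stepOp m lam M K)^[n] v K * lawInt m l lam M K α (fun _ => 1)| ≤
      missProb m lam K ^ n * (2 * D) *
        ((∫ b in Set.Ico 0 K, |dens m l lam M K α b|) + |fullProb m lam K α|) := by
  have hK0 := (capacity_pos hl hM hK).le
  rw [← lawInt_stepOp_iterate hm hl hlam hM hK hα hv n,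
    ← lawInt_sub_const _ _ _ _ _ (hv.stepOp_iterate hm hlam n).adm]
  exact abs_lawInt_le _ _ _ _ hK0 _ fun b hb =>
    OscLE.stepOp_iterate hm hlam hK0 hv (hv.oscLE K) n b hb K ⟨hK0, le_rfl⟩

theorem tendsto_missProb_pow (a : ℝ) : Tendsto (fun n : ℕ => missProb m lam K ^ n * a) atTop (𝓝 0) := by
  have h := missProb_nonneg_lt_one hm hlam (capacity_pos hl hM hK).le
  simpa using (tendsto_pow_atTop_nhds_zero_of_lt_one h.1 h.2).mul_const a

theorem tendsto_stepOp_iterate {α : Fin m → ℝ} (hα : defect m l lam M K α = 0) {v : ℝ → ℝ} {D : ℝ}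
    (hv : BddMeas D v) : Tendsto (fun n => (stepOp m lam M K)^[n] v K *
      lawInt m l lam M K α (fun _ => 1)) atTop (𝓝 (lawInt m l lam M K α v)) := by
  rw [tendsto_iff_dist_tendsto_zero]
  refine squeeze_zero (fun _ => dist_nonneg) (fun n => ?_)
    (tendsto_missProb_pow hm hl hlam hM hK (2 * D *
      ((∫ b in Set.Ico 0 K, |dens m l lam M K α b|) + |fullProb m lam K α|)))
  rw [dist_comm, Real.dist_eq, ← mul_assoc]
  exact abs_lawInt_sub_le hm hl hlam hM hK hα hv n

/-- With mass `0` the limit of the iterates makes every integral against the law vanish. Zero defect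
says that `α` consists of such integrals. -/
theorem eq_zero_of_lawInt_one_eq_zero {α : Fin m → ℝ} (hα : defect m l lam M K α = 0)
    (h1 : lawInt m l lam M K α (fun _ => 1) = 0) : α = 0 := by
  have h0 : ∀ v, Adm K v → lawInt m l lam M K α v = 0 := by
    intro v hv
    obtain ⟨D, hD⟩ := hv.exists_bddMeas
    have h := tendsto_stepOp_iterate hm hl hlam hM hK hα hD
    simp only [h1, mul_zero] at h
    rw [← lawInt_indicator _ _ _ _ (capacity_pos hl hM hK).le]
    exact tendsto_nhds_unique h tendsto_const_nhds
  funext r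
  have h2 := congrFun hα r
  rw [defect, h0 _ (adm_expMoment ..), sub_zero] at h2
  exact h2

/-- The integral is the limit of iterates of the positive operator `stepOp` evaluated at `K`, so no
sign information on `α` is required. -/
theorem lawInt_nonneg {α : Fin m → ℝ} (hα : defect m l lam M K α = 0)
    (h1 : lawInt m l lam M K α (fun _ => 1) = 1) {v : ℝ → ℝ} (hv : Adm K v)
    (hv0 : ∀ b ∈ Set.Icc 0 K, 0 ≤ v b) : 0 ≤ lawInt m l lam M K α v := by
  obtain ⟨D, hD⟩ := hv.exists_bddMeas
  have h := tendsto_stepOp_iterate hm hl hlam hM hK hα hD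
  rw [lawInt_indicator _ _ _ _ (capacity_pos hl hM hK).le, h1] at h
  refine ge_of_tendsto' h fun n => ?_
  rw [mul_one]
  have : ∀ x, 0 ≤ (stepOp m lam M K)^[n] ((Set.Icc 0 K).indicator v) x := by
    induction n with
    | zero => exact fun x => Set.indicator_nonneg hv0 x
    | succ n ih =>
      rw [Function.iterate_succ_apply']
      exact stepOp_nonneg m lam M K ih
  exact this K

/-- At zero defect the density at `x` is the integral of the nonnegative Erlang kernel against the
law; this gives the sign at every point, not merely almost everywhere. -/
theorem dens_nonneg {α : Fin m → ℝ} (hα : defect m l lam M K α = 0)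
    (h1 : lawInt m l lam M K α (fun _ => 1) = 1) {x : ℝ} (hx : x ∈ Set.Ico 0 K) :
    0 ≤ dens m l lam M K α x := by
  have h := lawInt_nonneg hm hl hlam hM hK hα h1 (adm_erl m lam M K x)
    fun b _ => erl_nonneg hm hlam _
  by_cases hxM : x < M
  · rwa [lawInt_erl_of_lt hl hlam.ne' hK α hx.1 hxM] at h
  · rw [lawInt_erl_of_mem hm hl hM hK α (not_lt.mp hxM) hx.2, hα] at h
    simpa [expPoly] using h

theorem fullProb_pos {α : Fin m → ℝ} (hα : defect m l lam M K α = 0)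
    (h1 : lawInt m l lam M K α (fun _ => 1) = 1) : 0 < fullProb m lam K α := by
  have hK0 := (capacity_pos hl hM hK).le
  have := isProbabilityMeasure_gamma hm hlam
  have hq := missProb_nonneg_lt_one hm hlam hK0
  set v : ℝ → ℝ := ({K} : Set ℝ).indicator 1 with hv
  have hvm : Measurable v := measurable_one.indicator (measurableSet_singleton K)
  have hvb : BddMeas 1 v := by
    refine ⟨hvm, fun x => ?_⟩
    rw [hv, Set.indicator_apply]
    split_ifs <;> simp
  have hp : lawInt m l lam M K α v = fullProb m lam K α := by
    rw [lawInt, setIntegral_eq_zero_of_forall_eq_zero, zero_add]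
    · simp [hv]
    · intro b hb
      rw [hv, Set.indicator_of_notMem (by simpa using hb.2.ne), zero_mul]
  -- From every level the buffer is full after one step with probability at least `1 - missProb`; by
  -- stationarity the atom has at least this mass.
  have h2 : 0 ≤ lawInt m l lam M K α (fun b => stepOp m lam M K v b - (1 - missProb m lam K)) := by
    refine lawInt_nonneg hm hl hlam hM hK hα h1 ((hvb.stepOp hm hlam).adm.sub (Adm.const _)) ?_
    intro b hb
    have h3 : 1 - missProb m lam K =
        ∫ y, (Set.Ici K).indicator (1 : ℝ → ℝ) y ∂gammaMeasure (m : ℝ) lam := by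
      rw [integral_indicator_one measurableSet_Ici, missProb, ← Set.compl_Ici,
        probReal_compl_eq_one_sub measurableSet_Ici]
      ring
    rw [sub_nonneg, h3, stepOp]
    refine integral_mono ((integrable_const (1 : ℝ)).indicator measurableSet_Ici)
      (hvb.integrable_step hm hlam M K b) fun y => ?_
    by_cases hy : y ∈ Set.Ici K
    · dsimp only
      rw [Set.indicator_of_mem hy, step_eq_of_le hb.1 hy]
      simp [hv]
    · rw [Set.indicator_of_notMem hy]
      exact Set.indicator_nonneg (fun _ _ => zero_le_one) _
  rw [lawInt_sub_const _ _ _ _ _ (hvb.stepOp hm hlam).adm, lawInt_stepOp hm hl hlam hM hK hα hvb, hp,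
    h1] at h2
  linarith

end

end OnOff

namespace OnOff

/-! ### Independence along the process -/

/-- Regrouping of independence: both hypotheses together say that the joint law is a triple product,
and associativity of product measures does the rest. -/
theorem indepFun_prod_left {Ω α β γ : Type*} [MeasurableSpace Ω] [MeasurableSpace α]
    [MeasurableSpace β] [MeasurableSpace γ] {P : Measure Ω} [IsProbabilityMeasure P]
    {U : Ω → α} {V : Ω → β} {W : Ω → γ} (hU : Measurable U) (hV : Measurable V) (hW : Measurable W)
    (h1 : IndepFun U (fun ω => (V ω, W ω)) P) (h2 : IndepFun V W P) :
    IndepFun (fun ω => (U ω, V ω)) W P := by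
  have h3 : IndepFun U V P := h1.comp measurable_id measurable_fst
  have _ := Measure.isProbabilityMeasure_map (μ := P) hU.aemeasurable
  have _ := Measure.isProbabilityMeasure_map (μ := P) hV.aemeasurable
  have _ := Measure.isProbabilityMeasure_map (μ := P) hW.aemeasurable
  rw [indepFun_iff_map_prod_eq_prod_map_map hU.aemeasurable (hV.prodMk hW).aemeasurable,
    (indepFun_iff_map_prod_eq_prod_map_map hV.aemeasurable hW.aemeasurable).mp h2] at h1
  rw [indepFun_iff_map_prod_eq_prod_map_map (hU.prodMk hV).aemeasurable hW.aemeasurable,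
    (indepFun_iff_map_prod_eq_prod_map_map hU.aemeasurable hV.aemeasurable).mp h3]
  apply MeasurableEquiv.prodAssoc.map_measurableEquiv_injective
  rw [Measure.prodAssoc_prod, ← h1, Measure.map_map (MeasurableEquiv.measurable _)
    ((hU.prodMk hV).prodMk hW)]
  rfl

section
variable {Ω : Type u} [MeasurableSpace Ω] {P : Measure Ω} {m : ℕ} {lam M K : ℝ} {B X : ℕ → Ω → ℝ}

theorem IsStorageProcess.measurable (h : IsStorageProcess P m lam M K B X) (i : ℕ) :
    Measurable (B i) := by
  induction i with
  | zero => exact h.measurable_init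
  | succ i ih =>
    rw [funext (h.storage_eq i)]
    exact (measurable_step M K).comp (ih.prodMk (h.measurable_harvest i))

theorem IsStorageProcess.exists_eq (h : IsStorageProcess P m lam M K B X) (i : ℕ) :
    ∃ Ψ : ℝ × (Finset.range i → ℝ) → ℝ, Measurable Ψ ∧ ∀ ω, B i ω = Ψ (B 0 ω, fun j => X j ω) := by
  induction i with
  | zero => exact ⟨Prod.fst, measurable_fst, fun _ => rfl⟩
  | succ i ih =>
    obtain ⟨Ψ, hΨ, hB⟩ := ih
    refine ⟨fun z => step M K (Ψ (z.1, fun j => z.2 ⟨j, Finset.mem_range.mpr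
      ((Finset.mem_range.mp j.2).trans (Nat.lt_succ_self i))⟩))
      (z.2 ⟨i, Finset.self_mem_range_succ i⟩), ?_, fun ω => ?_⟩
    · refine (measurable_step M K).comp (Measurable.prodMk (hΨ.comp (measurable_fst.prodMk ?_)) ?_)
      · exact measurable_pi_lambda _ fun j => (measurable_pi_apply _).comp measurable_snd
      · exact (measurable_pi_apply _).comp measurable_snd
    · rw [h.storage_eq, hB]

/-- The level `B i` is a function of `B 0` and the harvests before time `i`, and this pair is
independent of `X i`. -/
theorem IsStorageProcess.indepFun [IsProbabilityMeasure P] (h : IsStorageProcess P m lam M K B X)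
    (i : ℕ) : IndepFun (B i) (X i) P := by
  obtain ⟨Ψ, hΨ, hB⟩ := h.exists_eq i
  have hV : Measurable fun ω => fun j : Finset.range i => X j ω :=
    measurable_pi_lambda _ fun j => h.measurable_harvest j
  have h1 : IndepFun (fun ω => fun j : Finset.range i => X j ω) (X i) P := by
    have h2 := h.harvest_indep.indepFun_finset (Finset.range i) {i} (by simp) h.measurable_harvest
    exact h2.comp (φ := id) (ψ := fun x : (({i} : Finset ℕ) → ℝ) => x ⟨i, Finset.mem_singleton_self i⟩)
      measurable_id (measurable_pi_apply _)
  have h3 : IndepFun (B 0) (fun ω => ((fun j : Finset.range i => X j ω), X i ω)) P := by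
    refine h.init_indep.comp (φ := id) (ψ := fun x : ℕ → ℝ => ((fun j : Finset.range i => x j), x i))
      measurable_id (Measurable.prodMk ?_ (measurable_pi_apply _))
    exact measurable_pi_lambda _ fun j => measurable_pi_apply _
  have h4 := indepFun_prod_left h.measurable_init hV (h.measurable_harvest i) h3 h1
  rw [funext hB]
  exact h4.comp (φ := Ψ) (ψ := id) hΨ measurable_id

theorem IsStorageProcess.integral_succ [IsProbabilityMeasure P] (hm : 0 < m) (hlam : 0 < lam)
    (h : IsStorageProcess P m lam M K B X) {D : ℝ} {v : ℝ → ℝ} (hv : BddMeas D v) (i : ℕ) :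
    ∫ ω, v (B (i + 1) ω) ∂P = ∫ ω, stepOp m lam M K v (B i ω) ∂P := by
  have _ := isProbabilityMeasure_gamma hm hlam
  have hB := h.measurable i
  have hX := h.measurable_harvest i
  have _ := Measure.isProbabilityMeasure_map (μ := P) hB.aemeasurable
  have h1 := (indepFun_iff_map_prod_eq_prod_map_map hB.aemeasurable hX.aemeasurable).mp (h.indepFun i)
  rw [h.harvest_law] at h1
  have hvs : Measurable fun z : ℝ × ℝ => v (step M K z.1 z.2) := hv.1.comp (measurable_step M K)
  have h2 := integral_map (hB.prodMk hX).aemeasurable (μ := P) hvs.aestronglyMeasurable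
  rw [h1, integral_prod _ (Integrable.of_bound hvs.aestronglyMeasurable D
    (Eventually.of_forall fun z => hv.2 _))] at h2
  have h3 := integral_map hB.aemeasurable (μ := P)
    (hv.stepOp (M := M) (K := K) hm hlam).1.aestronglyMeasurable
  simp_rw [h.storage_eq]
  exact h2.symm.trans h3

theorem IsStorageProcess.integral_eq [IsProbabilityMeasure P] (hm : 0 < m) (hlam : 0 < lam)
    (h : IsStorageProcess P m lam M K B X) {D : ℝ} {v : ℝ → ℝ} (hv : BddMeas D v) (i : ℕ) :
    ∫ ω, v (B i ω) ∂P = ∫ ω, (stepOp m lam M K)^[i] v (B 0 ω) ∂P := by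
  induction i generalizing v with
  | zero => rfl
  | succ i ih =>
    rw [h.integral_succ hm hlam hv, ih (hv.stepOp hm hlam), Function.iterate_succ_apply]

theorem IsStorageProcess.abs_integral_sub_le [IsProbabilityMeasure P] (hm : 0 < m) (hlam : 0 < lam)
    (hK : 0 ≤ K) (h : IsStorageProcess P m lam M K B X) {D : ℝ} {v : ℝ → ℝ} (hv : BddMeas D v) (i : ℕ) :
    |∫ ω, v (B i ω) ∂P - (stepOp m lam M K)^[i] v K| ≤ missProb m lam K ^ i * (2 * D) := by
  have hw := hv.stepOp_iterate (M := M) (K := K) hm hlam i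
  have h1 : Integrable (fun ω => (stepOp m lam M K)^[i] v (B 0 ω)) P :=
    Integrable.of_bound (hw.1.comp h.measurable_init).aestronglyMeasurable D
      (Eventually.of_forall fun z => hw.2 _)
  have h2 : ∫ ω, ((stepOp m lam M K)^[i] v (B 0 ω) - (stepOp m lam M K)^[i] v K) ∂P =
      ∫ ω, v (B i ω) ∂P - (stepOp m lam M K)^[i] v K := by
    rw [integral_sub h1 (integrable_const _), h.integral_eq hm hlam hv]
    simp
  rw [← h2, ← Real.norm_eq_abs]
  refine (norm_integral_le_of_norm_le_const (C := missProb m lam K ^ i * (2 * D)) ?_).trans_eq (by simp)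
  filter_upwards [h.init_mem] with ω hω
  exact OscLE.stepOp_iterate hm hlam hK hv (hv.oscLE K) i _ hω K ⟨hK, le_rfl⟩

end

/-! ### The limiting law -/

theorem integral_densityAtom {m l : ℕ} {lam M K : ℝ} {α : Fin m → ℝ}
    (h0 : ∀ x ∈ Set.Ico 0 K, 0 ≤ dens m l lam M K α x) (hp : 0 ≤ fullProb m lam K α) {v : ℝ → ℝ}
    {D : ℝ} (hv : BddMeas D v) :
    ∫ x, v x ∂densityAtom K (dens m l lam M K α) (fullProb m lam K α) = lawInt m l lam M K α v := by
  have hd := adm_dens m l lam M K α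
  have _ : IsFiniteMeasure ((volume.restrict (Set.Ico 0 K)).withDensity
      fun x => ENNReal.ofReal (dens m l lam M K α x)) :=
    isFiniteMeasure_withDensity_ofReal hd.integrableOn.2
  have _ : IsFiniteMeasure (ENNReal.ofReal (fullProb m lam K α) • Measure.dirac K) :=
    Measure.smul_finite _ ENNReal.ofReal_ne_top
  have hi : ∀ (μ : Measure ℝ) [IsFiniteMeasure μ], Integrable v μ := fun μ _ =>
    Integrable.of_bound hv.1.aestronglyMeasurable D (Eventually.of_forall fun z => hv.2 _)
  rw [densityAtom, integral_add_measure (hi _) (hi _), integral_smul_measure, integral_dirac,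
    integral_withDensity_eq_integral_toReal_smul hd.1.ennreal_ofReal (by simp), lawInt,
    ENNReal.toReal_ofReal hp, smul_eq_mul]
  congr 1
  refine setIntegral_congr_fun measurableSet_Ico fun x hx => ?_
  rw [ENNReal.toReal_ofReal (h0 x hx), smul_eq_mul, mul_comm]

theorem bddMeas_indicator {s : Set ℝ} (hs : MeasurableSet s) : BddMeas 1 (s.indicator 1) := by
  refine ⟨measurable_one.indicator hs, fun x => ?_⟩
  classical
  rw [Set.indicator_apply]
  split_ifs <;> simp

theorem isFiniteMeasure_densityAtom (m l : ℕ) (lam M K p : ℝ) (α : Fin m → ℝ) :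
    IsFiniteMeasure (densityAtom K (dens m l lam M K α) p) := by
  have _ : IsFiniteMeasure ((volume.restrict (Set.Ico 0 K)).withDensity
      fun x => ENNReal.ofReal (dens m l lam M K α x)) :=
    isFiniteMeasure_withDensity_ofReal (adm_dens m l lam M K α).integrableOn.2
  have _ : IsFiniteMeasure (ENNReal.ofReal p • Measure.dirac K) :=
    Measure.smul_finite _ ENNReal.ofReal_ne_top
  exact isFiniteMeasureAdd

theorem isLimitingLaw_densityAtom {m l : ℕ} (hm : 0 < m) (hl : 3 ≤ l) {lam M K : ℝ} (hlam : 0 < lam)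
    (hM : 0 < M) (hK : K = l * M) {α : Fin m → ℝ} (hα : defect m l lam M K α = 0)
    (h1 : lawInt m l lam M K α (fun _ => 1) = 1) :
    IsLimitingLaw.{u} m lam M K (densityAtom K (dens m l lam M K α) (fullProb m lam K α)) := by
  have hK0 := (capacity_pos hl hM hK).le
  have _ := isProbabilityMeasure_gamma hm hlam
  have hint : ∀ {v : ℝ → ℝ} {D : ℝ}, BddMeas D v → _ := fun {v D} hv => integral_densityAtom (v := v) (D := D)
    (fun x hx => dens_nonneg hm hl hlam hM hK hα h1 hx) (fullProb_pos hm hl hlam hM hK hα h1).le hv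
  have hfin := isFiniteMeasure_densityAtom m l lam M K (fullProb m lam K α) α
  set π := densityAtom K (dens m l lam M K α) (fullProb m lam K α) with hπ
  have hreal : ∀ s, MeasurableSet s → π.real s = lawInt m l lam M K α (s.indicator 1) := fun s hs => by
    rw [← integral_indicator_one hs, hint (bddMeas_indicator hs)]
  have hprob : IsProbabilityMeasure π := by
    constructor
    have h2 := hreal Set.univ MeasurableSet.univ
    rw [Set.indicator_univ] at h2
    change π.real Set.univ = lawInt m l lam M K α (fun _ => 1) at h2
    rw [h1, measureReal_def] at h2
    exact (ENNReal.toReal_eq_one_iff _).mp h2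
  refine ⟨hprob, ?_, ?_, ?_⟩
  · have h2 := hreal (Set.Icc 0 K)ᶜ measurableSet_Icc.compl
    rw [lawInt_congr (w := fun _ => 0) hK0 α fun b hb => Set.indicator_of_notMem (by simpa using hb) _] at h2
    simp only [lawInt, zero_mul, integral_zero, mul_zero, add_zero] at h2
    rwa [measureReal_eq_zero_iff] at h2
  · rw [IsStationaryLaw]
    have hs := measurable_step M K
    have _ : IsProbabilityMeasure ((π.prod (gammaMeasure (m : ℝ) lam)).map
      (fun p : ℝ × ℝ => step M K p.1 p.2)) := Measure.isProbabilityMeasure_map hs.aemeasurable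
    refine Measure.ext fun s hsm => ?_
    have hv := bddMeas_indicator hsm
    have hvs : Measurable fun z : ℝ × ℝ => s.indicator (1 : ℝ → ℝ) (step M K z.1 z.2) := hv.1.comp hs
    refine (ENNReal.toReal_eq_toReal_iff' (measure_ne_top _ _) (measure_ne_top _ _)).mp ?_
    rw [← measureReal_def, ← measureReal_def, hreal s hsm, ← integral_indicator_one hsm,
      integral_map hs.aemeasurable hv.1.aestronglyMeasurable, integral_prod _
      (Integrable.of_bound hvs.aestronglyMeasurable 1 (Eventually.of_forall fun z => hv.2 _)),
      ← lawInt_stepOp hm hl hlam hM hK hα hv, ← hint (hv.stepOp hm hlam)]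
    rfl
  · intro Ω _ P _ B X hBX
    rw [Metric.tendstoUniformlyOn_iff]
    intro e he
    set V := (∫ b in Set.Ico 0 K, |dens m l lam M K α b|) + |fullProb m lam K α|
    -- Both the law of `B i` and `π` are compared with the `i`-th iterate at `K`; the two errors add
    -- up to `missProb ^ i` times this constant. All indicators have the bound `1`, so the estimate
    -- is uniform in `s`.
    filter_upwards [(tendsto_missProb_pow hm hl hlam hM hK (2 * 1 * V + 2 * 1)).eventually
      (gt_mem_nhds he)] with i hi s hs
    have hv := bddMeas_indicator hs
    have e1 := abs_lawInt_sub_le hm hl hlam hM hK hα hv i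
    have e2 := hBX.abs_integral_sub_le hm hlam hK0 hv i
    have e3 : ∫ ω, s.indicator (1 : ℝ → ℝ) (B i ω) ∂P = (P.map (B i)).real s := by
      rw [← integral_map (hBX.measurable i).aemeasurable (hv.1.aestronglyMeasurable),
        integral_indicator_one hs]
    rw [h1, mul_one, ← hreal s hs] at e1
    rw [e3, abs_sub_comm] at e2
    rw [Real.dist_eq]
    refine (abs_sub_le _ ((stepOp m lam M K)^[i] (s.indicator 1) K) _).trans_lt
      ((add_le_add e1 e2).trans_lt ?_)
    rw [mul_add] at hi
    linarith [mul_assoc (missProb m lam K ^ i) (2 * 1) V]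

end OnOff

namespace OnOff

open scoped Nat

/-! ### The linear system -/

theorem lawInt_eq_dotProduct {m l : ℕ} {lam M K : ℝ} (α : Fin m → ℝ) {v : ℝ → ℝ} (hv : Adm K v) :
    lawInt m l lam M K α v = (fun r : Fin m => 1 / ((r : ℕ)! : ℝ) * basisInt m l lam M K r v) ⬝ᵥ α := by
  rw [lawInt_eq _ _ _ _ _ hv, dotProduct]
  exact Finset.sum_congr rfl fun r _ => by ring

theorem mulVec_eq {m l : ℕ} (hl : 3 ≤ l) {lam M K : ℝ} (hlam : lam ≠ 0) (hM : 0 < M)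
    (hK : K = l * M) (α : Fin m → ℝ) (s : Fin m) :
    (1 + coeffMatrix m l lam M K).mulVec α s =
      defect m l lam M K α s + lawInt m l lam M K α (fun _ => 1) := by
  have h : (coeffMatrix m l lam M K).mulVec α s = lawInt m l lam M K α (fun _ => 1) -
      lawInt m l lam M K α (expMoment lam M K s) := by
    rw [lawInt_eq _ _ _ _ _ (Adm.const 1), lawInt_eq _ _ _ _ _ (adm_expMoment ..),
      ← Finset.sum_sub_distrib, Matrix.mulVec, dotProduct]
    refine Finset.sum_congr rfl fun r _ => ?_
    rw [coeffMatrix_eq hl hlam hM hK]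
    ring
  rw [Matrix.add_mulVec, Matrix.one_mulVec, Pi.add_apply, h, defect]
  ring

noncomputable section

/-- The defect as a linear map. -/
def defectMap (m l : ℕ) (lam M K : ℝ) : (Fin m → ℝ) →ₗ[ℝ] (Fin m → ℝ) where
  toFun := defect m l lam M K
  map_add' α β := by
    funext r
    simp only [defect, lawInt_eq _ _ _ _ _ (adm_expMoment ..), Pi.add_apply, add_div, add_mul,
      Finset.sum_add_distrib]
    ring
  map_smul' a α := by
    funext r
    simp only [defect, lawInt_eq _ _ _ _ _ (adm_expMoment ..), Pi.smul_apply, smul_eq_mul,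
      RingHom.id_apply, mul_sub, Finset.mul_sum]
    congr 1
    exact Finset.sum_congr rfl fun _ _ => by ring

/-- The left null vector of the defect map. -/
def nullVec (m : ℕ) (lam M K : ℝ) (r : Fin m) : ℝ :=
  1 / ((r : ℕ)! : ℝ) * ∑ t ∈ Finset.range (m - r), (lam * (M - K)) ^ t / (t ! : ℝ)

end

theorem nullVec_dotProduct_defect {m l : ℕ} (hm : 0 < m) (hl : 3 ≤ l) {lam M K : ℝ} (hlam : 0 < lam)
    (hM : 0 < M) (hK : K = l * M) (α : Fin m → ℝ) :
    nullVec m lam M K ⬝ᵥ defect m l lam M K α = 0 := by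
  rw [← sum_defect hm hl hlam hM hK α, dotProduct]
  refine Finset.sum_congr rfl fun r _ => ?_
  rw [nullVec]
  ring

/-- In the last entry the inner sum reduces to its term `t = 0`, so the null vector is nonzero for
all parameters. -/
theorem nullVec_last {m : ℕ} (hm : 0 < m) (lam M K : ℝ) :
    nullVec m lam M K ⟨m - 1, Nat.sub_lt hm one_pos⟩ ≠ 0 := by
  have h : m - (m - 1) = 1 := by omega
  simp only [nullVec, h]
  simp [Nat.factorial_ne_zero]

/-- Collecting the triangular double sum along the diagonals `r + t = n` produces the binomial
expansion of `(1 + lam * (M - K)) ^ n / n!`. -/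
theorem sum_nullVec (m : ℕ) (lam M K : ℝ) :
    nullVec m lam M K ⬝ᵥ (fun _ => 1) =
      ∑ n ∈ Finset.range m, (1 - lam * (K - M)) ^ n / (n ! : ℝ) := by
  have h := Finset.sum_range_diag_flip m fun r t : ℕ =>
    1 / (r ! : ℝ) * ((lam * (M - K)) ^ t / (t ! : ℝ))
  simp only [dotProduct, nullVec, mul_one]
  rw [Fin.sum_univ_eq_sum_range (fun r => 1 / (r ! : ℝ) *
    ∑ t ∈ Finset.range (m - r), (lam * (M - K)) ^ t / (t ! : ℝ)) m]
  simp_rw [Finset.mul_sum]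
  rw [← h]
  refine Finset.sum_congr rfl fun n _ => ?_
  rw [show 1 - lam * (K - M) = 1 + lam * (M - K) by ring, add_pow, Finset.sum_div]
  refine Finset.sum_congr rfl fun k hk => ?_
  rw [Nat.cast_choose ℝ (Nat.lt_succ_iff.mp (Finset.mem_range.mp hk)), one_pow]
  have : (n ! : ℝ) ≠ 0 := by positivity
  field_simp

/-- Existence does not pass through invertibility of `1 + A`, which may fail; it uses only that the
defect map is an endomorphism with a left null vector. -/
theorem exists_defect_eq_zero {m l : ℕ} (hm : 0 < m) (hl : 3 ≤ l) {lam M K : ℝ} (hlam : 0 < lam)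
    (hM : 0 < M) (hK : K = l * M) : ∃ α : Fin m → ℝ, defect m l lam M K α = 0 ∧
      lawInt m l lam M K α (fun _ => 1) = 1 := by
  have h1 : ¬ Function.Surjective (defectMap m l lam M K) := by
    intro hs
    obtain ⟨α, hα⟩ := hs (Pi.single ⟨m - 1, Nat.sub_lt hm one_pos⟩ 1)
    have h2 := nullVec_dotProduct_defect hm hl hlam hM hK α
    change defect m l lam M K α = _ at hα
    rw [hα, dotProduct_single_one] at h2
    exact nullVec_last hm lam M K h2
  rw [← LinearMap.injective_iff_surjective, injective_iff_map_eq_zero] at h1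
  push Not at h1
  obtain ⟨α, hα, h0⟩ := h1
  have h2 : lawInt m l lam M K α (fun _ => 1) ≠ 0 := fun h =>
    h0 (eq_zero_of_lawInt_one_eq_zero hm hl hlam hM hK hα h)
  refine ⟨(lawInt m l lam M K α (fun _ => 1))⁻¹ • α, ?_, ?_⟩
  · change defectMap m l lam M K _ = 0
    rw [map_smul, hα, smul_zero]
  · rw [lawInt_eq_dotProduct _ (Adm.const 1), dotProduct_smul, ← lawInt_eq_dotProduct _ (Adm.const 1),
      smul_eq_mul, inv_mul_cancel₀ h2]

theorem det_ne_zero_iff {m l : ℕ} (hm : 0 < m) (hl : 3 ≤ l) {lam M K : ℝ} (hlam : 0 < lam)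
    (hM : 0 < M) (hK : K = l * M) : (1 + coeffMatrix m l lam M K).det ≠ 0 ↔
      nullVec m lam M K ⬝ᵥ (fun _ => 1) ≠ 0 := by
  have hvec : ∀ α, (1 + coeffMatrix m l lam M K).mulVec α =
      defect m l lam M K α + lawInt m l lam M K α (fun _ => 1) • (fun _ => 1) := by
    intro α
    funext s
    rw [mulVec_eq hl hlam.ne' hM hK]
    simp
  have hdot : ∀ α, nullVec m lam M K ⬝ᵥ (1 + coeffMatrix m l lam M K).mulVec α =
      lawInt m l lam M K α (fun _ => 1) * (nullVec m lam M K ⬝ᵥ fun _ => 1) := by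
    intro α
    rw [hvec, dotProduct_add, nullVec_dotProduct_defect hm hl hlam hM hK, zero_add, dotProduct_smul,
      smul_eq_mul]
  refine not_congr ⟨fun h => ?_, fun h => ?_⟩
  · by_contra hne
    obtain ⟨α, h0, hα⟩ := Matrix.exists_mulVec_eq_zero_iff.mpr h
    have h1 := hdot α
    rw [hα, dotProduct_zero, eq_comm] at h1
    have h2 := (mul_eq_zero.mp h1).resolve_right hne
    rw [hvec, h2, zero_smul, add_zero] at hα
    -- A kernel vector of mass zero has zero defect as well, since `(1 + A) α` is then the defect
    -- itself.
    exact h0 (eq_zero_of_lawInt_one_eq_zero hm hl hlam hM hK hα h2)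
  · refine Matrix.exists_vecMul_eq_zero_iff.mp ⟨nullVec m lam M K, fun h0 =>
      nullVec_last hm lam M K (congrFun h0 _), ?_⟩
    refine dotProduct_eq_zero _ fun w => ?_
    rw [← Matrix.dotProduct_mulVec, hdot, h, mul_zero]

/-! ### The explicit formulas for the density -/

theorem dens_eq_lowDensity {m l : ℕ} {lam M K x : ℝ} (α : Fin m → ℝ) (hx : x < M) :
    dens m l lam M K α x = lowDensity m l lam M K α x := by
  rw [dens, lowDensity]
  congr 1
  refine Finset.sum_congr rfl fun r _ => ?_
  congr 1
  have hexp : ∀ q : ℕ, Real.exp (-lam * M * (q + 1)) =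
      Real.exp (-lam * M * q) * Real.exp (-lam * M) := by
    intro q
    rw [← Real.exp_add]
    ring_nf
  have hterm : ∀ q n : ℕ, Real.exp (-lam * M * q) * mode m lam M (K - q * M) n x =
      lam ^ (n + m) * Real.exp (-lam * M * (q + 1)) * ∑ t ∈ Finset.range n,
        ((q + 1) * M - K) ^ (n - 1 - t) / (((n - 1 - t)! : ℝ) * ((m + t)! : ℝ)) * C m lam x t := by
    intro q n
    rw [mode, if_pos hx, low, hexp, show M - (K - q * M) = (q + 1) * M - K by ring]
    have : ∀ t, ((q + 1) * M - K) ^ (n - 1 - t) / (((n - 1 - t)! : ℝ) * ((m + t)! : ℝ)) * C m lam x t =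
        ((q + 1) * M - K) ^ (n - 1 - t) / ((n - 1 - t)! : ℝ) * cyc m lam (m + t) x := by
      intro t
      rw [C_eq]
      have : ((m + t)! : ℝ) ≠ 0 := by positivity
      field_simp
    simp_rw [this]
    ring
  rw [profile]
  congr 1
  · refine Finset.sum_congr rfl fun q _ => ?_
    rw [hterm, show (q + 2) * m - r = (q + 1) * m - r + m by
      have := pos_degree r.isLt q
      have : (q + 2) * m = (q + 1) * m + m := by ring
      omega]
  · refine Finset.sum_congr rfl fun q _ => ?_
    rw [hterm, add_mul q, one_mul]

theorem dens_eq_stripeDensity {m l : ℕ} (hl : 3 ≤ l) {lam M K x : ℝ} (hM : 0 < M) (hK : K = l * M)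
    (α : Fin m → ℝ) {n : ℕ} (hn : n ∈ Finset.range (l - 1))
    (hx : x ∈ Set.Ico (max (K - (n + 1) * M) 0) (K - n * M)) :
    dens m l lam M K α x = stripeDensity m lam M K α n x := by
  have hnl := Finset.mem_range.mp hn
  have hx1 : K - (n + 1) * M ≤ x := (le_max_left _ _).trans hx.1
  have hMx : M ≤ x := by linarith [(break_bounds hl hM hK hn).1]
  -- On the `n`-th stripe the break points `K - q M` with `q ≤ n` lie to the right of `x`, so these
  -- truncated powers are active; all others vanish, which cuts the sums at `n`.
  have hin : ∀ q ≤ n, ∀ N, mode m lam M (K - q * M) N x =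
      lam ^ N * ((q * M + x - K) ^ (N - 1) / ((N - 1)! : ℝ)) := by
    intro q hq N
    have h1 : (q : ℝ) * M ≤ n * M := mul_le_mul_of_nonneg_right (by exact_mod_cast hq) hM.le
    rw [mode, if_neg hMx.not_gt, negPow, if_pos (by linarith [hx.2]), scaledPow,
      show x - (K - q * M) = q * M + x - K by ring, mul_div_assoc]
  have hout : ∀ q, n < q → ∀ N, mode m lam M (K - q * M) N x = 0 := by
    intro q hq N
    have h1 : ((n : ℝ) + 1) * M ≤ q * M := mul_le_mul_of_nonneg_right (by exact_mod_cast hq) hM.le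
    rw [mode, if_neg hMx.not_gt, negPow, if_neg (by linarith)]
  rw [dens, stripeDensity]
  congr 1
  refine Finset.sum_congr rfl fun r _ => ?_
  congr 1
  rw [profile]
  congr 1
  · rw [← Finset.sum_subset (s₁ := Finset.range (n + 1))]
    · refine Finset.sum_congr rfl fun q hq => ?_
      rw [hin q (Nat.lt_succ_iff.mp (Finset.mem_range.mp hq))]
      ring
    · exact Finset.range_subset_range.mpr (by omega)
    · intro q _ hq
      rw [hout q (by simpa using hq), mul_zero]
  · rw [← Finset.sum_subset (s₁ := Finset.Icc 1 n)]
    · refine Finset.sum_congr rfl fun q hq => ?_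
      rw [hin q (Finset.mem_Icc.mp hq).2]
      ring
    · exact Finset.Icc_subset_Icc_right (by omega)
    · intro q hq1 hq
      rw [Finset.mem_Icc] at hq hq1
      rw [hout q (by omega), mul_zero]

end OnOff

theorem mainTheorem6 (m l : ℕ) (hm : 1 ≤ m) (hl : 3 ≤ l) (Xbar lam M K : ℝ)
    (hXbar : 0 < Xbar) (hlam : lam = m / Xbar) (hM : 0 < M) (hK : K = l * M) :
    (∃ α : Fin m → ℝ,
      (1 + OnOff.coeffMatrix m l lam M K).mulVec α = (fun _ => 1) ∧
      ∃ g : ℝ → ℝ,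
        (∀ x ∈ Set.Ico 0 M, g x = OnOff.lowDensity m l lam M K α x) ∧
        (∀ n ∈ Finset.range (l - 1), ∀ x ∈ Set.Ico (max (K - (n + 1) * M) 0) (K - n * M),
          g x = OnOff.stripeDensity m lam M K α n x) ∧
        (∀ x ∈ Set.Ico 0 K, 0 ≤ g x) ∧
        0 < OnOff.fullProb m lam K α ∧
        OnOff.IsLimitingLaw.{u} m lam M K
          (OnOff.densityAtom K g (OnOff.fullProb m lam K α))) ∧
    ((1 + OnOff.coeffMatrix m l lam M K).det ≠ 0 ↔
      ∑ n ∈ Finset.range m, (1 - lam * (K - M)) ^ n / (n.factorial : ℝ) ≠ 0) := by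
  have hlam0 : 0 < lam := by
    rw [hlam]
    exact div_pos (by exact_mod_cast hm) hXbar
  constructor
  · obtain ⟨α, hα, h1⟩ := OnOff.exists_defect_eq_zero hm hl hlam0 hM hK
    refine ⟨α, ?_, OnOff.dens m l lam M K α, ?_, ?_, ?_, ?_, ?_⟩
    · funext s
      rw [OnOff.mulVec_eq hl hlam0.ne' hM hK, hα, h1]
      simp
    · exact fun x hx => OnOff.dens_eq_lowDensity α hx.2
    · exact fun n hn x hx => OnOff.dens_eq_stripeDensity hl hM hK α hn hx
    · exact fun x hx => OnOff.dens_nonneg hm hl hlam0 hM hK hα h1 hx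
    · exact OnOff.fullProb_pos hm hl hlam0 hM hK hα h1
    · exact OnOff.isLimitingLaw_densityAtom hm hl hlam0 hM hK hα h1
  · rw [OnOff.det_ne_zero_iff hm hl hlam0 hM hK, OnOff.sum_nullVec]
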